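/- **Theorem (convergence of minimizers of learning problems).** Let $T>0$, $p\in[1,\infty)$, $m,n\in\mathbb N$, $\beta_1,\beta_2,\beta_3\ge 0$, $b\in\mathbb R^m$, $x^0,y\in\mathbb R^n$. Let $\|\cdot\|_2$ be the Euclidean norm of vectors and the spectral norm of matrices, and equip $E:=\mathbb R^{m\times n}\times\mathbb R\times\mathbb R$ with the norm $\|(A,\alpha,\lambda)\|=\|A\|_2+|\alpha|+|\lambda|$. Assume: * (A1) $\mathcal R:\mathbb R^n\to\mathbb R$ is convex, with subdifferential $\partial\mathcal R$; * (A2) $0\in\partial\mathcal R(0)$; * (A3) there is $M>0$ such that for each $x\in\mathbb R^n$, either $\sup\{\|z\|_2: z\in\partial\mathcal R(x)\}\le M\|x\|_2$ or $\sup\{\|z\|_2: z\in\partial\mathcal R(x)\}\le M$; * (A4) $\mathcal L:\mathbb R^n\times\mathbb R^n\to\mathbb R$ is continuous and nonnegative; * (A5) $\psi:\mathbb R\to[0,\infty)$ is locally Lipschitz. For $N\ge 1$ divide $[0,T]$ into the intervals $\Omega^N_k=[kT/N,(k+1)T/N)$ for $0\le k\le N-2$ and $\Omega^N_{N-1}=[(N-1)T/N,T]$.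 For $V\in E^N$ let $\mathcal I_NV=\sum_{k}V_k\chi_{\Omega^N_k}$, and for $u\in L^1([0,T];E)$ let $(\mathcal P_Nu)_k=|\Omega^N_k|^{-1}\int_{\Omega^N_k}u(s)\,ds$. *Problem $(\mathfrak Q_N)$ over a set $\mathscr D_N\subseteq E^N$:* minimize, over $V=((A^k,\alpha^k,\lambda^k))_{k=0}^{N-1}\in\mathscr D_N$ and states $x^0,x^1,\dots,x^N\in\mathbb R^n$ starting at the given $x^0$ and satisfying $$0\in x^{k+1}-x^k+\tfrac TN\alpha^k(A^k)^\top(A^kx^k-b)+\tfrac TN\alpha^k\lambda^k\,\partial\mathcal R(x^{k+1}),\quad 0\le k\le N-1,$$ the cost $$\mathcal L(x^N;y)+\beta_1\psi\Big(\tfrac1N\sum_k\|A^k\|_2^p\Big)+\beta_2\psi\Big(\tfrac1N\sum_k|\alpha^k|^p\Big)+\beta_3\psi\Big(\tfrac1N\sum_k|\lambda^k|^p\Big).$$ *Problem $(\mathfrak Q)$ over a set $\mathscr D$ of controls:* minimize, over $(\mathbf A,\boldsymbol\alpha,\boldsymbol\lambda)\in\mathscr D$ and absolutely continuous $\mathbf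 x:[0,T]\to\mathbb R^n$ with $\mathbf x(0)=x^0$ and $$0\in\dot{\mathbf x}(t)+\boldsymbol\alpha(t)\mathbf A(t)^\top(\mathbf A(t)\mathbf x(t)-b)+\boldsymbol\alpha(t)\boldsymbol\lambda(t)\,\partial\mathcal R(\mathbf x(t))\quad\text{for a.e. }t\in[0,T],$$ the cost $$\mathcal L(\mathbf x(T);y)+\beta_1\psi\Big(\tfrac1T\int_0^T\|\mathbf A\|_2^p\,dt\Big)+\beta_2\psi\Big(\tfrac1T\int_0^T|\boldsymbol\alpha|^p\,dt\Big)+\beta_3\psi\Big(\tfrac1T\int_0^T|\boldsymbol\lambda|^p\,dt\Big).$$ A parameter $V$ (resp. a control) is called a solution of the problem if, together with some admissible state, it attains the minimum. Let $\mathscr D$ be a set of controls $(\mathbf A,\boldsymbol\alpha,\boldsymbol\lambda)\in L^\infty([0,T];E)$ with $\boldsymbol\alpha,\boldsymbol\lambda\ge0$ a.e. such that 1. $\mathscr D$ is bounded in $L^\infty([0,T];E)$; 2. $\mathscr D$ is closed in $L^p([0,T];E)$; 3. $\lim_{|h|\to0}\|u(\cdot+h)-u\|_{L^p(\mathbb R;E)}=0$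 uniformly in $u\in\mathscr D$, where $u$ is extended by $0$ outside $[0,T]$; 4. $\mathcal I_N\mathcal P_N\mathscr D\subseteq\mathscr D$ for every $N\ge1$. For every $N\ge1$ let $V_N^*\in\mathcal P_N\mathscr D$ be a solution of $(\mathfrak Q_N)$ over $\mathscr D_N=\mathcal P_N\mathscr D$. Then there are indices $N_1<N_2<\cdots$ and a control $u^*\in\mathscr D$ such that $\mathcal I_{N_i}V_{N_i}^*\to u^*$ in $L^p([0,T];E)$ and $u^*$ is a solution of $(\mathfrak Q)$ over $\mathscr D$. Moreover, whenever a subsequence of $(\mathcal I_NV_N^*)_{N\ge1}$ converges in $L^p([0,T];E)$, its limit belongs to $\mathscr D$ and is a solution of $(\mathfrak Q)$ over $\mathscr D$. -/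

import Mathlib

open MeasureTheory Set Filter Topology
open scoped ENNReal NNReal RealInnerProductSpace Matrix.Norms.L2Operator

namespace FBSNet

/-- Euclidean space `ℝⁿ` with the 2-norm. -/
abbrev Vec (n : ℕ) : Type := EuclideanSpace ℝ (Fin n)

/-- Parameter triples `(A, α, λ) ∈ ℝ^{m×n} × ℝ × ℝ` with the norm `‖A‖₂ + |α| + |λ|`, where `‖A‖₂`
is the spectral norm. -/
abbrev Param (m n : ℕ) : Type := WithLp 1 (Matrix (Fin m) (Fin n) ℝ × WithLp 1 (ℝ × ℝ))

namespace Param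

variable {m n : ℕ}

/-- The matrix `A` of the triple `(A, α, λ)`. -/
def mat (u : Param m n) : Matrix (Fin m) (Fin n) ℝ := u.fst

/-- The step size `α` of the triple `(A, α, λ)`. -/
def step (u : Param m n) : ℝ := u.snd.fst

/-- The trade-off parameter `λ` of the triple `(A, α, λ)`. -/
def reg (u : Param m n) : ℝ := u.snd.snd

/-- The norm on parameter triples is the sum of the three norms. -/
theorem norm_eq (u : Param m n) : ‖u‖ = ‖u.mat‖ + (|u.step| + |u.reg|) := by
  have h : ‖u.snd‖ = |u.snd.fst| + |u.snd.snd| := by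
    rw [WithLp.prod_norm_eq_add (by norm_num)]
    simp
  rw [WithLp.prod_norm_eq_add (by norm_num)]
  simp [mat, step, reg, h]

end Param

/-- Lebesgue measure on `[0,T]`. -/
noncomputable abbrev timeMeasure (T : ℝ) : Measure ℝ := volume.restrict (Icc 0 T)

/-- Controls `(𝐀, 𝛂, 𝛌) ∈ L^p([0,T]; ℝ^{m×n} × ℝ × ℝ)`. -/
abbrev Control (m n : ℕ) (T : ℝ) (p : ℝ≥0∞) : Type := Lp (Param m n) p (timeMeasure T)

/-- The convex subdifferential `(∂R)(x)`. -/
def subdifferential {n : ℕ} (R : Vec n → ℝ) (x : Vec n) : Set (Vec n) :=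
  {g | ∀ z, R x + ⟪g, z - x⟫ ≤ R z}

/-- The smooth part `α Aᵀ (A x - b)` of the vector field. -/
noncomputable def gradTerm {m n : ℕ} (b : Vec m) (u : Param m n) (x : Vec n) : Vec n :=
  u.step • u.mat.transpose.toEuclideanLin (u.mat.toEuclideanLin x - b)

/-! ### Partition, piecewise constant extension and averaging -/

/-- The `k`-th of the `N` subintervals of `[0,T]`: half-open, except for the last one, which is
closed. -/
noncomputable def cell (T : ℝ) (N : ℕ) (k : Fin N) : Set ℝ :=
  if (k : ℕ) + 1 = N then Icc ((k : ℕ) * (T / N)) T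
  else Ico ((k : ℕ) * (T / N)) (((k : ℕ) + 1) * (T / N))

theorem measurableSet_cell (T : ℝ) (N : ℕ) (k : Fin N) : MeasurableSet (cell T N k) := by
  unfold cell
  split_ifs
  · exact measurableSet_Icc
  · exact measurableSet_Ico

/-- The piecewise constant function with value `V k` on the `k`-th subinterval. -/
noncomputable def stepFun {X : Type*} [AddCommMonoid X] (T : ℝ) (N : ℕ) (V : Fin N → X) (t : ℝ) :
    X :=
  ∑ k, (cell T N k).indicator (fun _ => V k) t

theorem memLp_stepFun {X : Type*} [NormedAddCommGroup X] (T : ℝ) (p : ℝ≥0∞) (N : ℕ)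
    (V : Fin N → X) : MemLp (stepFun T N V) p (timeMeasure T) := by
  unfold stepFun
  exact memLp_finsetSum _ fun k _ => (memLp_const (V k)).indicator (measurableSet_cell T N k)

/-- The extension operator `I_N`, sending `N` parameter triples to a piecewise constant control. -/
noncomputable def extend {m n : ℕ} (T : ℝ) (p : ℝ≥0∞) {N : ℕ} (V : Fin N → Param m n) :
    Control m n T p :=
  (memLp_stepFun T p N V).toLp

/-- The projection operator `P_N`: averages of a control over the `N` subintervals. -/
noncomputable def average {m n : ℕ} {T : ℝ} {p : ℝ≥0∞} (N : ℕ) (u : Control m n T p) :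
    Fin N → Param m n :=
  fun k => (volume (cell T N k)).toReal⁻¹ • ∫ s in cell T N k, u s

/-! ### The training problem of the `N`-layer network -/

/-- `x` is the sequence of states of the `N`-layer network with parameters `V`, observation `b` and
initial state `x0`. -/
def IsNetworkState {m n : ℕ} (T : ℝ) (R : Vec n → ℝ) (b : Vec m) (x0 : Vec n) {N : ℕ}
    (V : Fin N → Param m n) (x : Fin (N + 1) → Vec n) : Prop :=
  x 0 = x0 ∧ ∀ k : Fin N, ∃ g ∈ subdifferential R (x k.succ),
    x k.succ - x k.castSucc + (T / N) • gradTerm b (V k) (x k.castSucc)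
      + ((T / N) * (V k).step * (V k).reg) • g = 0

/-- The objective of the `N`-layer training problem, for parameters `V` and output state `xN`. -/
noncomputable def networkCost {m n : ℕ} (p : ℝ≥0∞) (L : Vec n → Vec n → ℝ) (ψ : ℝ → ℝ)
    (β₁ β₂ β₃ : ℝ) (y : Vec n) {N : ℕ} (V : Fin N → Param m n) (xN : Vec n) : ℝ :=
  L xN y
    + β₁ * ψ ((1 / N) * ∑ k, ‖(V k).mat‖ ^ p.toReal)
    + β₂ * ψ ((1 / N) * ∑ k, |(V k).step| ^ p.toReal)
    + β₃ * ψ ((1 / N) * ∑ k, |(V k).reg| ^ p.toReal)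

/-- `V` solves the training problem of the `N`-layer network over the admissible set `DN`. -/
def SolvesNetworkProblem {m n : ℕ} (T : ℝ) (p : ℝ≥0∞) (R : Vec n → ℝ) (L : Vec n → Vec n → ℝ)
    (ψ : ℝ → ℝ) (β₁ β₂ β₃ : ℝ) (b : Vec m) (x0 y : Vec n) {N : ℕ}
    (DN : Set (Fin N → Param m n)) (V : Fin N → Param m n) : Prop :=
  V ∈ DN ∧ ∃ x, IsNetworkState T R b x0 V x ∧
    ∀ W ∈ DN, ∀ z, IsNetworkState T R b x0 W z →
      networkCost p L ψ β₁ β₂ β₃ y V (x (Fin.last N))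
        ≤ networkCost p L ψ β₁ β₂ β₃ y W (z (Fin.last N))

/-! ### The learning problem of the deep-layer limit system -/

/-- `x` is an absolutely continuous solution on `[0,T]` of the differential inclusion with control
`u`, observation `b` and initial state `x0`. -/
def IsTrajectory {m n : ℕ} {T : ℝ} {p : ℝ≥0∞} (R : Vec n → ℝ) (b : Vec m) (x0 : Vec n)
    (u : Control m n T p) (x : ℝ → Vec n) : Prop :=
  AbsolutelyContinuousOnInterval x 0 T ∧ x 0 = x0 ∧
    ∀ᵐ t ∂(timeMeasure T), ∃ v, HasDerivAt x v t ∧ ∃ g ∈ subdifferential R (x t),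
      v + gradTerm b (u t) (x t) + ((u t).step * (u t).reg) • g = 0

/-- The objective of the continuous learning problem, for a control `u` and final state `xT`. -/
noncomputable def controlCost {m n : ℕ} {T : ℝ} {p : ℝ≥0∞} (L : Vec n → Vec n → ℝ) (ψ : ℝ → ℝ)
    (β₁ β₂ β₃ : ℝ) (y : Vec n) (u : Control m n T p) (xT : Vec n) : ℝ :=
  L xT y
    + β₁ * ψ ((1 / T) * ∫ t in Icc 0 T, ‖(u t).mat‖ ^ p.toReal)
    + β₂ * ψ ((1 / T) * ∫ t in Icc 0 T, |(u t).step| ^ p.toReal)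
    + β₃ * ψ ((1 / T) * ∫ t in Icc 0 T, |(u t).reg| ^ p.toReal)

/-- `u` solves the continuous learning problem over the admissible set `D`. -/
def SolvesControlProblem {m n : ℕ} {T : ℝ} {p : ℝ≥0∞} (R : Vec n → ℝ) (L : Vec n → Vec n → ℝ)
    (ψ : ℝ → ℝ) (β₁ β₂ β₃ : ℝ) (b : Vec m) (x0 y : Vec n) (D : Set (Control m n T p))
    (u : Control m n T p) : Prop :=
  u ∈ D ∧ ∃ x, IsTrajectory R b x0 u x ∧
    ∀ w ∈ D, ∀ z, IsTrajectory R b x0 w z →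
      controlCost L ψ β₁ β₂ β₃ y u (x T) ≤ controlCost L ψ β₁ β₂ β₃ y w (z T)

/-! ### Conditions on the admissible set -/

/-- `D` is bounded in `L^∞([0,T])`. -/
def BoundedInLinfty {m n : ℕ} {T : ℝ} {p : ℝ≥0∞} (D : Set (Control m n T p)) : Prop :=
  ∃ C : ℝ≥0, ∀ u ∈ D, eLpNorm u ∞ (timeMeasure T) ≤ C

/-- The extension of a control by zero outside `[0,T]`. -/
noncomputable def zeroExtend {m n : ℕ} {T : ℝ} {p : ℝ≥0∞} (u : Control m n T p) : ℝ → Param m n :=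
  (Icc 0 T).indicator u

/-- `D` is `L^p(ℝ)`-equicontinuous under translations (after extension by zero). -/
def TranslationEquicontinuous {m n : ℕ} {T : ℝ} {p : ℝ≥0∞} (D : Set (Control m n T p)) : Prop :=
  ∀ ε : ℝ, 0 < ε → ∃ δ : ℝ, 0 < δ ∧ ∀ h : ℝ, |h| < δ → ∀ u ∈ D,
    eLpNorm (fun t => zeroExtend u (t + h) - zeroExtend u t) p volume < ENNReal.ofReal ε

end FBSNet

namespace FBSNet

/-! ### Convex subdifferentials -/

/-! The argument has the shape of a Γ-convergence proof: compactness of the admissible set,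
stability of the dynamics, and a recovery sequence for each competitor.

Stability is `exists_trajectory_of_tendsto`. For bounded parameters with nonnegative step sizes and
trade-offs, network states and their difference quotients are bounded uniformly in the depth
(`exists_networkState_bounds`), so the piecewise linear interpolants are equi-Lipschitz and
Arzelà–Ascoli applies. To pass to the limit without any convergence of derivatives, the inclusion is
replaced by an integrated evolution variational inequality: for every test point `z`, the growth of
`‖x - z‖² / 2` is at most the integral of an expression continuous in parameters and states. It
holds for interpolants up to an error of order `T / N` (`interpolant_evi`), survives dominated
convergence, and is turned back into the inclusion by differentiation (`ae_inclusion_of_evi`).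

A competitor `w` is approximated by its averages, which translation equicontinuity makes converge to
`w` in `L^p`. Their network states converge to some trajectory of `w`. Since the vector field is
monotone, all trajectories of `w` have the same endpoint (`IsTrajectory.eq_at_end`), so the limiting
cost is the cost of the given competing trajectory. Costs converge along both sequences
(`tendsto_networkCost`), so the discrete minimality inequality passes to the limit. Existence of a
convergent subsequence is Kolmogorov–Riesz compactness (`isCompact_of_translationEquicontinuous`).
-/

theorem subdifferential_nonempty {n : ℕ} {R : Vec n → ℝ} (hR : ConvexOn ℝ univ R) (x : Vec n) :
    (subdifferential R x).Nonempty := by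
  have hcont : Continuous R := hR.locallyLipschitz.continuous
  have hconv := hR.convex_strict_epigraph
  have hopen : IsOpen {q : Vec n × ℝ | q.1 ∈ univ ∧ R q.1 < q.2} := by
    simpa using isOpen_lt (hcont.comp continuous_fst) continuous_snd
  -- Separate the graph point from the open strict epigraph. The functional has negative vertical
  -- component `s`, so the hyperplane is not vertical and rescaling by `-s` yields a subgradient.
  obtain ⟨f, hf⟩ := geometric_hahn_banach_open_point (x := (x, R x)) hconv hopen (by simp)
  set s := f (0, 1) with hs
  have hdec : ∀ z r, f (z, r) = f (z, 0) + r * s := by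
    intro z r
    have : ((z, r) : Vec n × ℝ) = (z, 0) + r • (0, 1) := by simp
    rw [this, map_add, map_smul, smul_eq_mul]
  have hs0 : s < 0 := by
    have h := hf (x, R x + 1) (by simp)
    rw [hdec, hdec x (R x)] at h
    linarith
  let l : StrongDual ℝ (Vec n) := (-s)⁻¹ • f.comp (ContinuousLinearMap.inl ℝ (Vec n) ℝ)
  refine ⟨(InnerProductSpace.toDual ℝ (Vec n)).symm l, fun z => ?_⟩
  rw [InnerProductSpace.toDual_symm_apply]
  have key : f (z, 0) + R z * s ≤ f (x, 0) + R x * s := by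
    refine le_of_forall_pos_le_add fun ε hε => ?_
    -- Graph points lie outside the strict epigraph; this lift is chosen so that it costs exactly
    -- `ε`.
    have h := hf (z, R z + ε / (-s)) (by simpa using div_pos hε (neg_pos.2 hs0))
    rw [hdec, hdec x (R x)] at h
    have : ε / (-s) * s = -ε := by
      rw [div_neg, neg_mul, div_mul_cancel₀ _ hs0.ne]
    nlinarith
  have hl : l (z - x) = (-s)⁻¹ * (f (z, 0) - f (x, 0)) := by
    simp [l, ← map_sub]
  have h2 : (-s)⁻¹ * (f (z, 0) - f (x, 0)) ≤ R z - R x := by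
    rw [inv_mul_le_iff₀ (neg_pos.2 hs0)]
    linarith
  linarith

theorem inner_sub_nonneg_of_mem_subdifferential {n : ℕ} {R : Vec n → ℝ} {x z g k : Vec n}
    (hg : g ∈ subdifferential R x) (hk : k ∈ subdifferential R z) : 0 ≤ ⟪g - k, x - z⟫ := by
  have h1 := hg z
  have h2 := hk x
  have h3 : ⟪g, z - x⟫ = - ⟪g, x - z⟫ := by rw [← inner_neg_right, neg_sub]
  rw [inner_sub_left]
  linarith

/-- Variational characterization of `w ∈ c ∂R(x)`, for `c ≥ 0`. -/
theorem exists_mem_subdifferential_smul_eq {n : ℕ} {R : Vec n → ℝ} (hR : ConvexOn ℝ univ R) {c : ℝ}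
    (hc : 0 ≤ c) {x w : Vec n} (h : ∀ z, c * R x + ⟪w, z - x⟫ ≤ c * R z) :
    ∃ g ∈ subdifferential R x, c • g = w := by
  -- For `c = 0`, testing with `x + w` forces `w = 0`, but a subgradient must still be supplied,
  -- hence the appeal to nonemptiness.
  rcases hc.eq_or_lt with rfl | hc
  · obtain ⟨g, hg⟩ := subdifferential_nonempty hR x
    refine ⟨g, hg, ?_⟩
    have := h (x + w)
    simp only [zero_mul, add_sub_cancel_left, zero_add] at this
    rw [zero_smul, real_inner_self_nonpos.1 this]
  · refine ⟨c⁻¹ • w, fun z => ?_, by rw [smul_inv_smul₀ hc.ne']⟩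
    rw [real_inner_smul_left]
    have := h z
    have h2 : c⁻¹ * ⟪w, z - x⟫ ≤ R z - R x := by
      rw [inv_mul_le_iff₀ hc]; linarith
    linarith

/-- Solvability of the proximal step. -/
theorem exists_proximal_point {n : ℕ} {R : Vec n → ℝ} (hR : ConvexOn ℝ univ R)
    (h0 : (0 : Vec n) ∈ subdifferential R 0) {c : ℝ} (hc : 0 ≤ c) (v : Vec n) :
    ∃ x, ∃ g ∈ subdifferential R x, x - v + c • g = 0 := by
  have hcont : Continuous R := hR.locallyLipschitz.continuous
  have hmin : ∀ z, R 0 ≤ R z := fun z => by simpa using h0 z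
  -- The proximal point is a minimizer. As `0` is a subgradient at `0`, `R` is bounded below by `R
  -- 0`, which makes the objective coercive.
  obtain ⟨x, hx⟩ : ∃ x, ∀ z, ‖x - v‖ ^ 2 / 2 + c * R x ≤ ‖z - v‖ ^ 2 / 2 + c * R z := by
    refine Continuous.exists_forall_le' (f := fun z => ‖z - v‖ ^ 2 / 2 + c * R z) (by fun_prop) v ?_
    have ht : Tendsto (fun z : Vec n => ‖z - v‖ ^ 2 / 2 + c * R 0) (cocompact (Vec n)) atTop := by
      refine tendsto_atTop_add_const_right _ _ (Tendsto.atTop_div_const two_pos ?_)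
      refine (tendsto_pow_atTop two_ne_zero).comp ?_
      have h1 : Tendsto (fun z : Vec n => ‖z‖ - ‖v‖) (cocompact (Vec n)) atTop :=
        tendsto_atTop_add_const_right _ _ (tendsto_norm_cocompact_atTop)
      exact tendsto_atTop_mono (fun z => norm_sub_norm_le z v) h1
    filter_upwards [ht.eventually_ge_atTop (‖v - v‖ ^ 2 / 2 + c * R v)] with z hz
    exact hz.trans (by gcongr; exact hmin z)
  have hvar : ∀ z, c * R x + ⟪v - x, z - x⟫ ≤ c * R z := by
    intro z
    -- Compare the minimizer with the segment point `x + t (z - x)`, use convexity and divide by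
    -- `t`; the remaining quadratic term vanishes as `t → 0`.
    have hstep : ∀ t : ℝ, 0 < t → t ≤ 1 →
        c * R x + ⟪v - x, z - x⟫ ≤ c * R z + t * (‖z - x‖ ^ 2 / 2) := by
      intro t ht ht1
      have h1 := hx (x + t • (z - x))
      have h2 : R (x + t • (z - x)) ≤ (1 - t) * R x + t * R z := by
        have := hR.2 (mem_univ x) (mem_univ z) (sub_nonneg.2 ht1) ht.le (by ring)
        rwa [show (1 - t) • x + t • z = x + t • (z - x) by module] at this
      have h3 : ‖x + t • (z - x) - v‖ ^ 2
          = ‖x - v‖ ^ 2 - 2 * (t * ⟪v - x, z - x⟫) + t ^ 2 * ‖z - x‖ ^ 2 := by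
        rw [show x + t • (z - x) - v = (x - v) + t • (z - x) by abel, norm_add_sq_real,
          norm_smul, mul_pow, real_inner_smul_right, ← neg_sub v x, inner_neg_left, norm_neg]
        simp
        ring
      have h4 := mul_le_mul_of_nonneg_left h2 hc
      have h5 : t * (c * R x + ⟪v - x, z - x⟫) ≤ t * (c * R z + t * (‖z - x‖ ^ 2 / 2)) := by
        rw [h3] at h1
        nlinarith
      exact le_of_mul_le_mul_left h5 ht
    have hlim : Tendsto (fun t : ℝ => c * R z + t * (‖z - x‖ ^ 2 / 2)) (𝓝[>] 0)
        (𝓝 (c * R z + 0 * (‖z - x‖ ^ 2 / 2))) :=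
      (Continuous.tendsto (by fun_prop) 0).mono_left nhdsWithin_le_nhds
    rw [zero_mul, add_zero] at hlim
    refine ge_of_tendsto hlim ?_
    filter_upwards [Ioc_mem_nhdsGT one_pos] with t ht using hstep t ht.1 ht.2
  obtain ⟨g, hg, hgw⟩ := exists_mem_subdifferential_smul_eq hR hc hvar
  exact ⟨x, g, hg, by rw [hgw]; abel⟩

/-! ### The smooth part of the vector field -/

namespace Param

variable {m n : ℕ}

theorem norm_mat_le (u : Param m n) : ‖u.mat‖ ≤ ‖u‖ := by
  rw [norm_eq]; linarith [abs_nonneg u.step, abs_nonneg u.reg]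

theorem abs_step_le (u : Param m n) : |u.step| ≤ ‖u‖ := by
  rw [norm_eq]; linarith [norm_nonneg u.mat, abs_nonneg u.reg]

theorem abs_reg_le (u : Param m n) : |u.reg| ≤ ‖u‖ := by
  rw [norm_eq]; linarith [norm_nonneg u.mat, abs_nonneg u.step]

theorem continuous_mat : Continuous (mat : Param m n → _) :=
  continuous_fst.comp (WithLp.prod_continuous_ofLp 1 _ _)

theorem continuous_step : Continuous (step : Param m n → ℝ) :=
  continuous_fst.comp ((WithLp.prod_continuous_ofLp 1 _ _).comp
    (continuous_snd.comp (WithLp.prod_continuous_ofLp 1 _ _)))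

theorem continuous_reg : Continuous (reg : Param m n → ℝ) :=
  continuous_snd.comp ((WithLp.prod_continuous_ofLp 1 _ _).comp
    (continuous_snd.comp (WithLp.prod_continuous_ofLp 1 _ _)))

/-- The step size as a continuous linear functional. -/
noncomputable def stepL : Param m n →L[ℝ] ℝ where
  toFun := step
  map_add' _ _ := rfl
  map_smul' _ _ := rfl
  cont := continuous_step

/-- The trade-off parameter as a continuous linear functional. -/
noncomputable def regL : Param m n →L[ℝ] ℝ where
  toFun := reg
  map_add' _ _ := rfl
  map_smul' _ _ := rfl
  cont := continuous_reg

end Param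

theorem norm_toEuclideanLin_le {m n : ℕ} (A : Matrix (Fin m) (Fin n) ℝ) (x : Vec n) :
    ‖A.toEuclideanLin x‖ ≤ ‖A‖ * ‖x‖ :=
  Matrix.l2_opNorm_mulVec A x

theorem norm_transpose_l2 {m n : ℕ} (A : Matrix (Fin m) (Fin n) ℝ) : ‖A.transpose‖ = ‖A‖ := by
  rw [← Matrix.conjTranspose_eq_transpose_of_trivial, Matrix.l2_opNorm_conjTranspose]

theorem inner_transpose_toEuclideanLin {m n : ℕ} (A : Matrix (Fin m) (Fin n) ℝ) (x : Vec m)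
    (z : Vec n) : ⟪A.transpose.toEuclideanLin x, z⟫ = ⟪x, A.toEuclideanLin z⟫ := by
  rw [← Matrix.conjTranspose_eq_transpose_of_trivial, Matrix.toEuclideanLin_conjTranspose_eq_adjoint,
    LinearMap.adjoint_inner_left]

theorem continuous_toEuclideanLin {m n : ℕ} :
    Continuous fun q : Matrix (Fin m) (Fin n) ℝ × Vec n => q.1.toEuclideanLin q.2 := by
  simp only [Matrix.toLpLin_apply]
  fun_prop

theorem _root_.Continuous.toEuclideanLin_apply {X : Type*} [TopologicalSpace X] {m n : ℕ}
    {A : X → Matrix (Fin m) (Fin n) ℝ} {x : X → Vec n} (hA : Continuous A) (hx : Continuous x) :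
    Continuous fun q => (A q).toEuclideanLin (x q) :=
  continuous_toEuclideanLin.comp (hA.prodMk hx)

theorem continuous_gradTerm {m n : ℕ} (b : Vec m) :
    Continuous fun q : Param m n × Vec n => gradTerm b q.1 q.2 := by
  unfold gradTerm
  have hA : Continuous fun q : Param m n × Vec n => q.1.mat :=
    Param.continuous_mat.comp continuous_fst
  have hs : Continuous fun q : Param m n × Vec n => q.1.step :=
    Param.continuous_step.comp continuous_fst
  have hAt : Continuous fun q : Param m n × Vec n => q.1.mat.transpose := hA.matrix_transpose
  exact hs.smul (hAt.toEuclideanLin_apply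
    ((hA.toEuclideanLin_apply continuous_snd).sub continuous_const))

theorem norm_gradTerm_le {m n : ℕ} (b : Vec m) {C : ℝ} {u : Param m n} (hu : ‖u‖ ≤ C) (x : Vec n) :
    ‖gradTerm b u x‖ ≤ C * (C * (C * ‖x‖ + ‖b‖)) := by
  have hC : 0 ≤ C := (norm_nonneg u).trans hu
  unfold gradTerm
  rw [norm_smul, Real.norm_eq_abs]
  gcongr
  · exact u.abs_step_le.trans hu
  refine (norm_toEuclideanLin_le _ _).trans ?_
  rw [norm_transpose_l2]
  gcongr
  · exact u.norm_mat_le.trans hu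
  refine (norm_sub_le _ _).trans ?_
  gcongr
  refine (norm_toEuclideanLin_le _ _).trans ?_
  gcongr
  exact u.norm_mat_le.trans hu

/-- The inner product equals `α ‖A (x - z)‖²`. This monotonicity is half of the uniqueness argument;
the other half is monotonicity of the subdifferential. -/
theorem inner_gradTerm_sub_nonneg {m n : ℕ} (b : Vec m) {u : Param m n} (hu : 0 ≤ u.step)
    (x z : Vec n) : 0 ≤ ⟪gradTerm b u x - gradTerm b u z, x - z⟫ := by
  unfold gradTerm
  rw [← smul_sub, ← map_sub, real_inner_smul_left, inner_transpose_toEuclideanLin,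
    sub_sub_sub_cancel_right, ← map_sub]
  exact mul_nonneg hu real_inner_self_nonneg

/-! ### Step functions -/

section Cells

variable {T : ℝ} {N : ℕ}

theorem le_of_mem_cell {k : Fin N} {t : ℝ} (ht : t ∈ cell T N k) : (k : ℕ) * (T / N) ≤ t := by
  unfold cell at ht
  split_ifs at ht
  · exact ht.1
  · exact ht.1

theorem le_succ_of_mem_cell {k : Fin N} {t : ℝ} (ht : t ∈ cell T N k) :
    t ≤ ((k : ℕ) + 1) * (T / N) := by
  have hN : (N : ℝ) ≠ 0 := Nat.cast_ne_zero.2 (Nat.ne_of_gt (k.pos))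
  unfold cell at ht
  split_ifs at ht with h
  · rw [show ((k : ℕ) : ℝ) + 1 = N by exact_mod_cast h, mul_div_cancel₀ _ hN]
    exact ht.2
  · exact ht.2.le

theorem succ_mul_le (hT : 0 < T) (k : Fin N) : ((k : ℕ) + 1) * (T / N) ≤ T := by
  have hN : (0 : ℝ) < N := Nat.cast_pos.2 k.pos
  have hk : ((k : ℕ) : ℝ) + 1 ≤ N := by exact_mod_cast k.isLt
  calc ((k : ℕ) + 1) * (T / N) ≤ N * (T / N) := by gcongr
    _ = T := mul_div_cancel₀ _ hN.ne'

theorem cell_subset_Icc (hT : 0 < T) (k : Fin N) : cell T N k ⊆ Icc 0 T := fun t ht =>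
  ⟨(by positivity : (0 : ℝ) ≤ (k : ℕ) * (T / N)).trans (le_of_mem_cell ht),
    (le_succ_of_mem_cell ht).trans (succ_mul_le hT k)⟩

theorem Ico_subset_cell (hT : 0 < T) (k : Fin N) :
    Ico ((k : ℕ) * (T / N)) (((k : ℕ) + 1) * (T / N)) ⊆ cell T N k := by
  intro t ht
  unfold cell
  split_ifs
  · exact ⟨ht.1, ht.2.le.trans (succ_mul_le hT k)⟩
  · exact ht

theorem cell_subset_Icc_succ (k : Fin N) :
    cell T N k ⊆ Icc ((k : ℕ) * (T / N)) (((k : ℕ) + 1) * (T / N)) := fun _ ht =>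
  ⟨le_of_mem_cell ht, le_succ_of_mem_cell ht⟩

theorem volume_cell (hT : 0 < T) (k : Fin N) : volume (cell T N k) = ENNReal.ofReal (T / N) := by
  apply le_antisymm
  · refine (measure_mono (cell_subset_Icc_succ k)).trans ?_
    rw [Real.volume_Icc]; ring_nf; rfl
  · refine le_trans ?_ (measure_mono (Ico_subset_cell hT k))
    rw [Real.volume_Ico]; ring_nf; rfl

theorem exists_mem_cell (hT : 0 < T) (hN : 0 < N) {t : ℝ} (ht : t ∈ Icc 0 T) :
    ∃ k : Fin N, t ∈ cell T N k := by
  have hN' : (0 : ℝ) < N := Nat.cast_pos.2 hN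
  have hh : 0 < T / N := by positivity
  -- At `t = T` the floor formula would give the nonexistent index `N`; this point belongs to the
  -- closed last cell.
  rcases ht.2.eq_or_lt with rfl | htT
  · refine ⟨⟨N - 1, by omega⟩, ?_⟩
    unfold cell
    rw [if_pos (by simp; omega)]
    refine ⟨?_, le_rfl⟩
    calc ((N - 1 : ℕ) : ℝ) * (t / N) ≤ N * (t / N) := by gcongr; omega
      _ = t := mul_div_cancel₀ _ hN'.ne'
  · have hlt : ⌊t / (T / N)⌋₊ < N := by
      rw [Nat.floor_lt (by have := ht.1; positivity), div_lt_iff₀ hh, mul_div_cancel₀ _ hN'.ne']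
      exact htT
    refine ⟨⟨_, hlt⟩, Ico_subset_cell hT _ ⟨?_, ?_⟩⟩
    · rw [← le_div_iff₀ hh]
      exact Nat.floor_le (by have := ht.1; positivity)
    · rw [← div_lt_iff₀ hh]
      exact Nat.lt_floor_add_one _

theorem cell_index_le (hT : 0 < T) {j k : Fin N} {t : ℝ} (hj : t ∈ cell T N j)
    (hk : t ∈ cell T N k) : (k : ℕ) ≤ j := by
  by_contra! hlt
  have hN : (0 : ℝ) < N := Nat.cast_pos.2 k.pos
  have hne : ¬ ((j : ℕ) + 1 = N) := by have := k.isLt; omega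
  unfold cell at hj
  rw [if_neg hne] at hj
  have h1 := le_of_mem_cell hk
  have h2 : ((j : ℕ) : ℝ) + 1 ≤ (k : ℕ) := by exact_mod_cast hlt
  have h3 : (((j : ℕ) : ℝ) + 1) * (T / N) ≤ (k : ℕ) * (T / N) := by gcongr
  linarith [hj.2]

theorem cell_index_eq (hT : 0 < T) {j k : Fin N} {t : ℝ} (hj : t ∈ cell T N j)
    (hk : t ∈ cell T N k) : j = k :=
  Fin.ext (le_antisymm (cell_index_le hT hk hj) (cell_index_le hT hj hk))

theorem stepFun_of_mem {X : Type*} [AddCommMonoid X] (hT : 0 < T) (V : Fin N → X) {k : Fin N}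
    {t : ℝ} (ht : t ∈ cell T N k) : stepFun T N V t = V k := by
  unfold stepFun
  rw [Finset.sum_eq_single k, indicator_of_mem ht]
  · intro j _ hjk
    exact indicator_of_notMem (fun hj => hjk (cell_index_eq hT hj ht)) _
  · simp

theorem stepFun_of_notMem {X : Type*} [AddCommMonoid X] (hT : 0 < T) (V : Fin N → X) {t : ℝ}
    (ht : t ∉ Icc 0 T) : stepFun T N V t = 0 :=
  Finset.sum_eq_zero fun k _ => indicator_of_notMem (fun h => ht (cell_subset_Icc hT k h)) _

theorem norm_stepFun_le {X : Type*} [NormedAddCommGroup X] (hT : 0 < T) {V : Fin N → X} {K : ℝ}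
    (hK : 0 ≤ K) (hV : ∀ k, ‖V k‖ ≤ K) (t : ℝ) : ‖stepFun T N V t‖ ≤ K := by
  rcases N.eq_zero_or_pos with rfl | hN
  · simpa [stepFun] using hK
  by_cases ht : t ∈ Icc 0 T
  · obtain ⟨k, hk⟩ := exists_mem_cell hT hN ht
    rw [stepFun_of_mem hT V hk]
    exact hV k
  · rw [stepFun_of_notMem hT V ht, norm_zero]
    exact hK

theorem stronglyMeasurable_stepFun {X : Type*} [NormedAddCommGroup X] (V : Fin N → X) :
    StronglyMeasurable (stepFun T N V) := by
  unfold stepFun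
  exact Finset.stronglyMeasurable_fun_sum _ fun k _ =>
    stronglyMeasurable_const.indicator (measurableSet_cell T N k)

theorem locallyIntegrable_stepFun {X : Type*} [NormedAddCommGroup X] (hT : 0 < T) (V : Fin N → X) :
    LocallyIntegrable (stepFun T N V) := by
  refine (integrable_finsetSum (μ := volume) Finset.univ fun k _ =>
    (integrable_indicator_iff (measurableSet_cell T N k)).2
      (integrableOn_const (C := V k) ?_)).locallyIntegrable
  rw [volume_cell hT]
  exact ENNReal.ofReal_ne_top

theorem integral_comp_stepFun {X : Type*} [NormedAddCommGroup X] (hT : 0 < T) (hN : 0 < N)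
    (V : Fin N → X) (F : X → ℝ) :
    ∫ t in Icc 0 T, F (stepFun T N V t) = (T / N) * ∑ k, F (V k) := by
  -- Applying `F` commutes with `stepFun` only on `[0,T]`, because `F 0` may be nonzero.
  have h1 : ∫ t in Icc 0 T, F (stepFun T N V t)
      = ∫ t in Icc 0 T, ∑ k, (cell T N k).indicator (fun _ => F (V k)) t := by
    refine setIntegral_congr_fun measurableSet_Icc fun t ht => ?_
    obtain ⟨k, hk⟩ := exists_mem_cell hT hN ht
    have h2 := stepFun_of_mem hT (fun k => F (V k)) hk
    simp only [stepFun_of_mem hT V hk]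
    exact h2.symm
  rw [h1, integral_finsetSum, Finset.mul_sum]
  · refine Finset.sum_congr rfl fun k _ => ?_
    rw [setIntegral_indicator (measurableSet_cell T N k),
      inter_eq_self_of_subset_right (cell_subset_Icc hT k), setIntegral_const, measureReal_def,
      volume_cell hT, ENNReal.toReal_ofReal (by positivity), smul_eq_mul]
  · intro k _
    exact (integrable_const (F (V k))).indicator (measurableSet_cell T N k)

theorem sub_mem_cell_le {k : Fin N} {s t : ℝ} (hs : s ∈ cell T N k) (ht : t ∈ cell T N k) :
    |s - t| ≤ T / N := by
  have h1 := le_of_mem_cell hs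
  have h2 := le_of_mem_cell ht
  have h3 := le_succ_of_mem_cell hs
  have h4 := le_succ_of_mem_cell ht
  rw [abs_le]
  constructor <;> nlinarith

end Cells

/-! ### Piecewise linear interpolation -/

/-- The piecewise linear interpolation of a sequence of states. -/
noncomputable def interpolant {n : ℕ} (T : ℝ) (N : ℕ) (X : Fin (N + 1) → Vec n) (t : ℝ) : Vec n :=
  X 0 + ∫ s in (0 : ℝ)..t, stepFun T N (fun k => (T / N)⁻¹ • (X k.succ - X k.castSucc)) s

section Interpolant

variable {n N : ℕ} {T : ℝ} {X : Fin (N + 1) → Vec n}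

theorem norm_difference_quotient_le (hT : 0 < T) {K : ℝ}
    (hX : ∀ k : Fin N, ‖X k.succ - X k.castSucc‖ ≤ K * (T / N)) (k : Fin N) :
    ‖(T / N)⁻¹ • (X k.succ - X k.castSucc)‖ ≤ K := by
  have hN : (0 : ℝ) < N := Nat.cast_pos.2 k.pos
  have hh : 0 < T / N := by positivity
  rw [norm_smul, norm_inv, Real.norm_eq_abs, abs_of_pos hh, inv_mul_le_iff₀ hh, mul_comm]
  exact hX k

theorem intervalIntegrable_stepFun {Y : Type*} [NormedAddCommGroup Y] (hT : 0 < T) (V : Fin N → Y)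
    (a c : ℝ) : IntervalIntegrable (stepFun T N V) volume a c :=
  intervalIntegrable_iff.2
    (((locallyIntegrable_stepFun hT V).integrableOn_isCompact isCompact_uIcc).mono_set
      uIoc_subset_uIcc)

theorem interpolant_sub (hT : 0 < T) (s t : ℝ) :
    interpolant T N X t - interpolant T N X s
      = ∫ r in s..t, stepFun T N (fun k => (T / N)⁻¹ • (X k.succ - X k.castSucc)) r := by
  unfold interpolant
  rw [add_sub_add_left_eq_sub, intervalIntegral.integral_interval_sub_left] <;>
  exact intervalIntegrable_stepFun hT _ _ _

theorem interpolant_zero : interpolant T N X 0 = X 0 := by simp [interpolant]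

theorem lipschitzWith_interpolant (hT : 0 < T) {K : ℝ≥0}
    (hX : ∀ k : Fin N, ‖X k.succ - X k.castSucc‖ ≤ K * (T / N)) :
    LipschitzWith K (interpolant T N X) := by
  refine LipschitzWith.of_dist_le_mul fun s t => ?_
  rw [dist_eq_norm, interpolant_sub hT, Real.dist_eq]
  exact intervalIntegral.norm_integral_le_of_norm_le_const fun r _ =>
    norm_stepFun_le hT K.2 (norm_difference_quotient_le hT hX) r

theorem interpolant_node (hT : 0 < T) (k : ℕ) (hk : k < N + 1) :
    interpolant T N X (k * (T / N)) = X ⟨k, hk⟩ := by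
  induction k with
  | zero => simpa using interpolant_zero
  | succ k ih =>
    have hkN : k < N := by omega
    have hN : (0 : ℝ) < N := Nat.cast_pos.2 (by omega)
    have hh : 0 < T / N := by positivity
    have h1 := interpolant_sub (X := X) hT (k * (T / N)) ((k + 1 : ℕ) * (T / N))
    rw [ih (by omega), intervalIntegral.integral_congr_ae
      (g := fun _ => (T / N)⁻¹ • (X ⟨k + 1, hk⟩ - X ⟨k, by omega⟩))] at h1
    · rw [intervalIntegral.integral_const, ← sub_mul] at h1
      push_cast at h1
      rw [add_sub_cancel_left, one_mul, smul_inv_smul₀ hh.ne'] at h1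
      have := sub_left_injective h1
      exact_mod_cast this
    · have hne : ∀ᵐ r : ℝ, r ≠ (k + 1 : ℕ) * (T / N) := by simp [ae_iff]
      filter_upwards [hne] with r hr hmem
      rw [uIoc_of_le (by gcongr; omega)] at hmem
      have hcell : r ∈ cell T N ⟨k, hkN⟩ :=
        Ico_subset_cell hT _ ⟨hmem.1.le, by simpa using lt_of_le_of_ne hmem.2 hr⟩
      rw [stepFun_of_mem hT _ hcell]
      rfl

theorem interpolant_end (hT : 0 < T) (hN : 0 < N) : interpolant T N X T = X (Fin.last N) := by
  have h := interpolant_node (X := X) hT N (Nat.lt_succ_self N)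
  rwa [mul_div_cancel₀ _ (Nat.cast_ne_zero.2 hN.ne')] at h

theorem norm_interpolant_sub_castSucc_le (hT : 0 < T) {K : ℝ≥0}
    (hX : ∀ k : Fin N, ‖X k.succ - X k.castSucc‖ ≤ K * (T / N)) {k : Fin N} {t : ℝ}
    (ht : t ∈ cell T N k) : ‖interpolant T N X t - X k.castSucc‖ ≤ K * (T / N) := by
  have h : X k.castSucc = interpolant T N X ((k : ℕ) * (T / N)) :=
    (interpolant_node hT k (by omega)).symm
  rw [h, ← dist_eq_norm]
  refine ((lipschitzWith_interpolant hT hX).dist_le_mul _ _).trans ?_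
  gcongr
  rw [Real.dist_eq, abs_of_nonneg (by linarith [le_of_mem_cell ht])]
  linarith [le_succ_of_mem_cell ht]

theorem norm_interpolant_sub_succ_le (hT : 0 < T) {K : ℝ≥0}
    (hX : ∀ k : Fin N, ‖X k.succ - X k.castSucc‖ ≤ K * (T / N)) {k : Fin N} {t : ℝ}
    (ht : t ∈ cell T N k) : ‖interpolant T N X t - X k.succ‖ ≤ K * (T / N) := by
  have h : X k.succ = interpolant T N X (((k : ℕ) + 1 : ℕ) * (T / N)) :=
    (interpolant_node hT (k + 1) (by omega)).symm
  rw [h, ← dist_eq_norm]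
  refine ((lipschitzWith_interpolant hT hX).dist_le_mul _ _).trans ?_
  gcongr
  push_cast
  rw [dist_comm, Real.dist_eq, abs_of_nonneg (by linarith [le_succ_of_mem_cell ht])]
  linarith [le_of_mem_cell ht]

end Interpolant

/-! ### Network states -/

theorem exists_isNetworkState {m n : ℕ} {T : ℝ} (hT : 0 ≤ T) {R : Vec n → ℝ}
    (hR : ConvexOn ℝ univ R) (h0 : (0 : Vec n) ∈ subdifferential R 0) (b : Vec m) (x0 : Vec n)
    {N : ℕ} {V : Fin N → Param m n} (hV : ∀ k, 0 ≤ (V k).step ∧ 0 ≤ (V k).reg) :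
    ∃ X, IsNetworkState T R b x0 V X := by
  have hprox : ∀ (k : Fin N) (x : Vec n), ∃ x', ∃ g ∈ subdifferential R x',
      x' - x + (T / N) • gradTerm b (V k) x + ((T / N) * (V k).step * (V k).reg) • g = 0 := by
    intro k x
    obtain ⟨x', g, hg, h⟩ := exists_proximal_point hR h0
      (mul_nonneg (mul_nonneg (div_nonneg hT N.cast_nonneg) (hV k).1) (hV k).2)
      (x - (T / N) • gradTerm b (V k) x)
    exact ⟨x', g, hg, by rw [← h]; abel⟩
  choose F hF using hprox
  refine ⟨Fin.induction x0 F, by simp, fun k => ?_⟩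
  simp only [Fin.induction_succ]
  exact hF k _

/-- A priori bound for the states of a network. -/
theorem norm_networkState_le {m n : ℕ} {T : ℝ} (hT : 0 < T) {R : Vec n → ℝ}
    (h0 : (0 : Vec n) ∈ subdifferential R 0) {b : Vec m} {x0 : Vec n} {C : ℝ} (hC : 0 ≤ C)
    {N : ℕ} {V : Fin N → Param m n} (hV : ∀ k, 0 ≤ (V k).step ∧ 0 ≤ (V k).reg)
    (hVC : ∀ k, ‖V k‖ ≤ C) {X : Fin (N + 1) → Vec n} (hX : IsNetworkState T R b x0 V X)
    (k : Fin (N + 1)) :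
    ‖X k‖ + 1 ≤ Real.exp (T * (C * C * (C + ‖b‖))) * (‖x0‖ + 1) := by
  -- With this `γ` the affine bound on `gradTerm` is at most `γ (‖x‖ + 1)`, so one layer multiplies
  -- `‖x‖ + 1` by at most `1 + hγ ≤ exp (hγ)`: a discrete Gronwall argument.
  set γ := C * C * (C + ‖b‖) with hγ
  have hγ0 : 0 ≤ γ := by positivity
  have hind : ∀ (k : ℕ) (hk : k < N + 1),
      ‖X ⟨k, hk⟩‖ + 1 ≤ Real.exp (k * (T / N) * γ) * (‖x0‖ + 1) := by
    intro k
    induction k with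
    | zero => intro hk; simpa using (congrArg norm hX.1).le
    | succ k ih =>
      intro hk
      have hN : (0 : ℝ) < N := Nat.cast_pos.2 (by omega)
      obtain ⟨g, hg, hgX⟩ := hX.2 ⟨k, by omega⟩
      have ih := ih (by omega)
      set κ : Fin N := ⟨k, by omega⟩
      have e1 : X κ.succ = X ⟨k + 1, hk⟩ := rfl
      have e2 : X κ.castSucc = X ⟨k, by omega⟩ := rfl
      rw [e1] at hg
      rw [e1, e2] at hgX
      set x' := X ⟨k + 1, hk⟩
      set x := X ⟨k, by omega⟩
      set h := T / N with hh
      have hh0 : 0 < h := by positivity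
      have hmono : 0 ≤ ⟪g, x'⟫ := by
        simpa using inner_sub_nonneg_of_mem_subdifferential hg h0
      have heq : x' + (h * (V κ).step * (V κ).reg) • g = x - h • gradTerm b (V κ) x := by
        rw [← sub_eq_zero, ← hgX]; abel
      -- The implicit step does not increase the norm: pair its equation with `x'` and use `⟪g, x'⟫
      -- ≥ 0`.
      have hle : ‖x'‖ ≤ ‖x - h • gradTerm b (V κ) x‖ := by
        have h1 : ‖x'‖ * ‖x'‖ ≤ ‖x - h • gradTerm b (V κ) x‖ * ‖x'‖ := by
          refine le_trans ?_ (real_inner_le_norm _ _)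
          rw [← heq, inner_add_left, real_inner_smul_left, real_inner_self_eq_norm_mul_norm]
          have := mul_nonneg (mul_nonneg (mul_nonneg hh0.le (hV κ).1) (hV κ).2) hmono
          linarith
        rcases (norm_nonneg x').eq_or_lt with h2 | h2
        · rw [← h2]; exact norm_nonneg _
        · exact le_of_mul_le_mul_right h1 h2
      have hf : ‖h • gradTerm b (V κ) x‖ ≤ h * (γ * (‖x‖ + 1)) := by
        rw [norm_smul, Real.norm_eq_abs, abs_of_pos hh0]
        gcongr
        refine (norm_gradTerm_le b (hVC κ) x).trans ?_
        rw [hγ, mul_assoc C C, mul_assoc C, mul_assoc C]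
        gcongr
        nlinarith [norm_nonneg x, norm_nonneg b, mul_nonneg (norm_nonneg x) (norm_nonneg b)]
      have hexp : 1 + h * γ ≤ Real.exp (h * γ) := by
        linarith [Real.add_one_le_exp (h * γ)]
      calc ‖x'‖ + 1 ≤ ‖x‖ + h * (γ * (‖x‖ + 1)) + 1 := by
            linarith [hle, norm_sub_le x (h • gradTerm b (V κ) x)]
        _ = (1 + h * γ) * (‖x‖ + 1) := by ring
        _ ≤ Real.exp (h * γ) * (Real.exp (k * h * γ) * (‖x0‖ + 1)) := by gcongr
        _ = Real.exp ((k + 1 : ℕ) * h * γ) * (‖x0‖ + 1) := by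
            rw [← mul_assoc, ← Real.exp_add]; push_cast; ring_nf
  refine (hind k k.isLt).trans ?_
  gcongr
  rcases N.eq_zero_or_pos with rfl | hN
  · simpa using hT.le
  calc ((k : ℕ) : ℝ) * (T / N) ≤ N * (T / N) := by gcongr; exact Nat.lt_succ_iff.1 k.isLt
    _ = T := mul_div_cancel₀ _ (Nat.cast_ne_zero.2 hN.ne')

/-- Uniform bounds for the states of networks and their increments, for bounded parameters. -/
theorem exists_networkState_bounds {m n : ℕ} {T : ℝ} (hT : 0 < T) {R : Vec n → ℝ}
    (h0 : (0 : Vec n) ∈ subdifferential R 0)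
    (hgrowth : ∃ M : ℝ, 0 < M ∧ ∀ x, (∀ z ∈ subdifferential R x, ‖z‖ ≤ M * ‖x‖) ∨
      (∀ z ∈ subdifferential R x, ‖z‖ ≤ M)) (b : Vec m) (x0 : Vec n) {C : ℝ} (hC : 0 ≤ C) :
    ∃ B K : ℝ≥0, ∀ (N : ℕ) (V : Fin N → Param m n), (∀ k, 0 ≤ (V k).step ∧ 0 ≤ (V k).reg) →
      (∀ k, ‖V k‖ ≤ C) → ∀ X, IsNetworkState T R b x0 V X →
        (∀ k, ‖X k‖ ≤ B) ∧ ∀ k : Fin N, ‖X k.succ - X k.castSucc‖ ≤ K * (T / N) := by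
  obtain ⟨M, hM, hMR⟩ := hgrowth
  set B := Real.exp (T * (C * C * (C + ‖b‖))) * (‖x0‖ + 1) with hB
  have hB0 : 0 ≤ B := by positivity
  refine ⟨⟨B, hB0⟩, ⟨C * (C * (C * B + ‖b‖)) + C * C * (M * B), by positivity⟩,
    fun N V hV hVC X hX => ?_⟩
  have hbd := norm_networkState_le hT h0 hC hV hVC hX
  rw [← hB] at hbd
  refine ⟨fun k => show ‖X k‖ ≤ B by linarith [hbd k], fun k => ?_⟩
  have hN : (0 : ℝ) < N := Nat.cast_pos.2 k.pos
  have hh0 : 0 < T / N := by positivity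
  obtain ⟨g, hg, hgX⟩ := hX.2 k
  -- Both growth alternatives fit under the same constant, since `B ≥ ‖X k.succ‖ + 1 ≥ 1`.
  have hgB : ‖g‖ ≤ M * B := by
    rcases hMR (X k.succ) with h | h
    · refine (h g hg).trans ?_
      gcongr
      linarith [hbd k.succ]
    · refine (h g hg).trans ?_
      nlinarith [hbd k.succ, norm_nonneg (X k.succ)]
  have hfB : ‖gradTerm b (V k) (X k.castSucc)‖ ≤ C * (C * (C * B + ‖b‖)) := by
    refine (norm_gradTerm_le b (hVC k) _).trans ?_
    gcongr
    linarith [hbd k.castSucc]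
  have heq : X k.succ - X k.castSucc = -((T / N) • gradTerm b (V k) (X k.castSucc)
      + ((T / N) * (V k).step * (V k).reg) • g) := by
    rw [eq_neg_iff_add_eq_zero, ← hgX]; abel
  rw [heq, norm_neg]
  refine (norm_add_le _ _).trans ?_
  rw [norm_smul, norm_smul, norm_mul, norm_mul, Real.norm_eq_abs, Real.norm_eq_abs,
    Real.norm_eq_abs, abs_of_pos hh0]
  have h1 : |(V k).step| ≤ C := (V k).abs_step_le.trans (hVC k)
  have h2 : |(V k).reg| ≤ C := (V k).abs_reg_le.trans (hVC k)
  calc T / N * ‖gradTerm b (V k) (X k.castSucc)‖ + T / N * |(V k).step| * |(V k).reg| * ‖g‖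
      ≤ T / N * (C * (C * (C * B + ‖b‖))) + T / N * C * C * (M * B) := by gcongr
    _ = (C * (C * (C * B + ‖b‖)) + C * C * (M * B)) * (T / N) := by ring

/-- The right-hand side of the evolution variational inequality with test point `z`. -/
noncomputable def eviRHS {m n : ℕ} (R : Vec n → ℝ) (b : Vec m) (z : Vec n) (u : Param m n)
    (x x' : Vec n) : ℝ :=
  u.step * u.reg * (R z - R x') + ⟪gradTerm b u x, z - x'⟫

/-- The discrete variational inequality is the subgradient inequality at the new state, scaled by
`αλ`. The scheme is explicit in the gradient and implicit in `R`, which is why `eviRHS` takes two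
states. -/
theorem inner_difference_quotient_le {m n : ℕ} {T : ℝ} (hT : 0 < T) {R : Vec n → ℝ} {b : Vec m}
    {x0 : Vec n} {N : ℕ} {V : Fin N → Param m n} (hV : ∀ k, 0 ≤ (V k).step ∧ 0 ≤ (V k).reg)
    {X : Fin (N + 1) → Vec n} (hX : IsNetworkState T R b x0 V X) (z : Vec n) (k : Fin N) :
    ⟪(T / N)⁻¹ • (X k.succ - X k.castSucc), X k.succ - z⟫
      ≤ eviRHS R b z (V k) (X k.castSucc) (X k.succ) := by
  have hN : (0 : ℝ) < N := Nat.cast_pos.2 k.pos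
  have hh0 : 0 < T / N := by positivity
  obtain ⟨g, hg, hgX⟩ := hX.2 k
  have heq : (T / N)⁻¹ • (X k.succ - X k.castSucc) = -(gradTerm b (V k) (X k.castSucc)
      + ((V k).step * (V k).reg) • g) := by
    rw [inv_smul_eq_iff₀ hh0.ne', smul_neg, smul_add, smul_smul, ← mul_assoc,
      eq_neg_iff_add_eq_zero, ← hgX]
    abel
  rw [heq, eviRHS, ← neg_sub z, inner_neg_neg, inner_add_left, real_inner_smul_left]
  have h1 := mul_le_mul_of_nonneg_left (hg z) (mul_nonneg (hV k).1 (hV k).2)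
  linarith

/-! ### Absolutely continuous functions -/

theorem _root_.AbsolutelyContinuousOnInterval.norm {E : Type*} [SeminormedAddCommGroup E]
    {f : ℝ → E} {a c : ℝ} (hf : AbsolutelyContinuousOnInterval f a c) :
    AbsolutelyContinuousOnInterval (fun t => ‖f t‖) a c := by
  unfold AbsolutelyContinuousOnInterval at hf ⊢
  refine squeeze_zero (fun _ => Finset.sum_nonneg fun _ _ => dist_nonneg) (fun q => ?_) hf
  refine Finset.sum_le_sum fun i _ => ?_
  rw [Real.dist_eq, dist_eq_norm]
  exact abs_norm_sub_norm_le _ _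

theorem _root_.AbsolutelyContinuousOnInterval.norm_sq_div_two {E : Type*} [SeminormedAddCommGroup E]
    {f : ℝ → E} {a c : ℝ} (hf : AbsolutelyContinuousOnInterval f a c) :
    AbsolutelyContinuousOnInterval (fun t => ‖f t‖ ^ 2 / 2) a c := by
  have h := (hf.norm.mul hf.norm).const_mul (1 / 2)
  have heq : (fun t => ‖f t‖ ^ 2 / 2) = fun t => 1 / 2 * ((fun t => ‖f t‖) * fun t => ‖f t‖) t := by
    ext t
    simp only [Pi.mul_apply]
    ring
  rw [heq]
  exact h

/-- The fundamental theorem of calculus for absolutely continuous functions, in the one-sided form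
needed for both the variational inequality and uniqueness. -/
theorem _root_.AbsolutelyContinuousOnInterval.sub_le_integral {φ G : ℝ → ℝ} {s t : ℝ} (hst : s ≤ t)
    (hφ : AbsolutelyContinuousOnInterval φ s t) (hG : IntervalIntegrable G volume s t)
    (h : ∀ᵐ r ∂(volume.restrict (Icc s t)), ∃ d, HasDerivAt φ d r ∧ d ≤ G r) :
    φ t - φ s ≤ ∫ r in s..t, G r := by
  rw [← hφ.integral_deriv_eq_sub]
  refine intervalIntegral.integral_mono_ae_restrict hst hφ.intervalIntegrable_deriv hG ?_
  filter_upwards [h] with r hr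
  obtain ⟨d, hd, hdG⟩ := hr
  rw [hd.deriv]
  exact hdG

theorem _root_.HasDerivAt.norm_sub_sq_div_two {E : Type*} [NormedAddCommGroup E]
    [InnerProductSpace ℝ E] {f : ℝ → E} {v : E} {t : ℝ} (hf : HasDerivAt f v t) (z : E) :
    HasDerivAt (fun r => ‖f r - z‖ ^ 2 / 2) ⟪v, f t - z⟫ t := by
  have h := (hf.sub_const z).norm_sq.div_const 2
  rw [mul_div_cancel_left₀ _ two_ne_zero, real_inner_comm] at h
  exact h

/-! ### The evolution variational inequality -/

theorem continuous_eviRHS {m n : ℕ} {R : Vec n → ℝ} (hR : Continuous R) (b : Vec m) (z : Vec n) :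
    Continuous fun q : Param m n × Vec n × Vec n => eviRHS R b z q.1 q.2.1 q.2.2 := by
  unfold eviRHS
  have h1 : Continuous fun q : Param m n × Vec n × Vec n => q.1.step :=
    Param.continuous_step.comp continuous_fst
  have h2 : Continuous fun q : Param m n × Vec n × Vec n => q.1.reg :=
    Param.continuous_reg.comp continuous_fst
  have h3 : Continuous fun q : Param m n × Vec n × Vec n => gradTerm b q.1 q.2.1 :=
    (continuous_gradTerm b).comp (continuous_fst.prodMk (continuous_fst.comp continuous_snd))
  exact ((h1.mul h2).mul (by fun_prop)).add (h3.inner (by fun_prop))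

theorem tendsto_eviRHS {m n : ℕ} {R : Vec n → ℝ} (hR : Continuous R) (b : Vec m) (z : Vec n)
    {ι : Type*} {l : Filter ι} {u : ι → Param m n} {x x' : ι → Vec n} {u₀ : Param m n}
    {x₀ x₀' : Vec n} (hu : Tendsto u l (𝓝 u₀)) (hx : Tendsto x l (𝓝 x₀))
    (hx' : Tendsto x' l (𝓝 x₀')) :
    Tendsto (fun i => eviRHS R b z (u i) (x i) (x' i)) l (𝓝 (eviRHS R b z u₀ x₀ x₀')) := by
  have h1 : Tendsto (fun i => (u i, x i, x' i)) l (𝓝 (u₀, x₀, x₀')) :=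
    hu.prodMk_nhds (hx.prodMk_nhds hx')
  have h2 : Tendsto (fun q : Param m n × Vec n × Vec n => eviRHS R b z q.1 q.2.1 q.2.2)
      (𝓝 (u₀, x₀, x₀')) (𝓝 (eviRHS R b z u₀ x₀ x₀')) :=
    (continuous_eviRHS hR b z).tendsto (u₀, x₀, x₀')
  have h3 := h2.comp h1
  simpa only [Function.comp_def] using h3

/-- Continuity on a compact product of balls; the bound serves as the dominating constant. -/
theorem exists_bound_eviRHS {m n : ℕ} {R : Vec n → ℝ} (hR : Continuous R) (b : Vec m) (z : Vec n)
    (C B : ℝ) : ∃ G : ℝ, ∀ (u : Param m n) (x x' : Vec n), ‖u‖ ≤ C → ‖x‖ ≤ B → ‖x'‖ ≤ B →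
      ‖eviRHS R b z u x x'‖ ≤ G := by
  have : FiniteDimensional ℝ (Param m n) := inferInstance
  have : ProperSpace (Param m n) := FiniteDimensional.proper_real _
  have hK : IsCompact (Metric.closedBall (0 : Param m n) C ×ˢ
      Metric.closedBall (0 : Vec n) B ×ˢ Metric.closedBall (0 : Vec n) B) :=
    (isCompact_closedBall _ _).prod ((isCompact_closedBall _ _).prod (isCompact_closedBall _ _))
  obtain ⟨G, hG⟩ := hK.exists_bound_of_continuousOn (continuous_eviRHS hR b z).continuousOn
  exact ⟨G, fun u x x' hu hx hx' => hG (u, x, x') ⟨by simpa using hu, by simpa using hx,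
    by simpa using hx'⟩⟩

/-- The pointwise inequality for all `z` is the variational form of `-v - gradTerm b u x ∈ αλ
∂R(x)`. -/
theorem exists_mem_subdifferential_of_forall_le {m n : ℕ} {R : Vec n → ℝ} (hR : ConvexOn ℝ univ R)
    {b : Vec m} {u : Param m n} (hu : 0 ≤ u.step ∧ 0 ≤ u.reg) {x v : Vec n}
    (h : ∀ z, ⟪v, x - z⟫ ≤ eviRHS R b z u x x) :
    ∃ g ∈ subdifferential R x, v + gradTerm b u x + (u.step * u.reg) • g = 0 := by
  obtain ⟨g, hg, hgw⟩ := exists_mem_subdifferential_smul_eq (x := x) (w := -v - gradTerm b u x)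
    hR (mul_nonneg hu.1 hu.2) (fun z => by
      have h1 := h z
      rw [eviRHS, ← neg_sub z x, inner_neg_right] at h1
      rw [inner_sub_left, inner_neg_left]
      linarith)
  exact ⟨g, hg, by rw [hgw]; abel⟩

/-- A Lipschitz solution of the integrated evolution variational inequality solves the differential
inclusion. -/
theorem ae_inclusion_of_evi {m n : ℕ} {T : ℝ} {R : Vec n → ℝ} (hR : ConvexOn ℝ univ R)
    {b : Vec m} {u : ℝ → Param m n}
    (hu : ∀ᵐ t ∂(timeMeasure T), 0 ≤ (u t).step ∧ 0 ≤ (u t).reg) {K : ℝ≥0} {x : ℝ → Vec n}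
    (hx : LipschitzWith K x)
    (hint : ∀ z, IntervalIntegrable (fun r => eviRHS R b z (u r) (x r) (x r)) volume 0 T)
    (hevi : ∀ z s t, 0 ≤ s → s ≤ t → t ≤ T → ‖x t - z‖ ^ 2 / 2 - ‖x s - z‖ ^ 2 / 2
      ≤ ∫ r in s..t, eviRHS R b z (u r) (x r) (x r)) :
    ∀ᵐ t ∂(timeMeasure T), ∃ v, HasDerivAt x v t ∧ ∃ g ∈ subdifferential R (x t),
      v + gradTerm b (u t) (x t) + ((u t).step * (u t).reg) • g = 0 := by
  have hRc : Continuous R := hR.locallyLipschitz.continuous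
  -- The exceptional null set depends on the test point, so only a dense sequence is used;
  -- continuity in `z` then gives all test points.
  have hleb : ∀ᵐ t, ∀ j, t ∈ uIcc 0 T → HasDerivAt
      (fun r => ∫ q in (0 : ℝ)..r, eviRHS R b (TopologicalSpace.denseSeq (Vec n) j) (u q) (x q) (x q))
      (eviRHS R b (TopologicalSpace.denseSeq (Vec n) j) (u t) (x t) (x t)) t := by
    rw [ae_all_iff]
    intro j
    filter_upwards [(hint (TopologicalSpace.denseSeq (Vec n) j)).ae_hasDerivAt_integral]
      with t ht hmem using ht hmem 0 left_mem_uIcc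
  have h0 : ∀ᵐ t : ℝ, t ≠ 0 := by simp [ae_iff]
  have h1 : ∀ᵐ t : ℝ, t ≠ T := by simp [ae_iff]
  filter_upwards [hu, ae_restrict_mem measurableSet_Icc, ae_restrict_of_ae hleb,
    ae_restrict_of_ae h0, ae_restrict_of_ae h1, ae_restrict_of_ae hx.ae_differentiableAt]
    with t hut htI hder ht0 htT hdiff
  have htIoo : t ∈ Ioo 0 T := ⟨lt_of_le_of_ne htI.1 ht0.symm, lt_of_le_of_ne htI.2 htT⟩
  have hT : 0 ≤ T := htI.1.trans htI.2
  refine ⟨deriv x t, hdiff.hasDerivAt, exists_mem_subdifferential_of_forall_le hR hut ?_⟩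
  refine fun z => (TopologicalSpace.denseRange_denseSeq (Vec n)).induction_on z
    (p := fun z => ⟪deriv x t, x t - z⟫ ≤ eviRHS R b z (u t) (x t) (x t)) ?_ ?_
  · refine isClosed_le (by fun_prop) ?_
    unfold eviRHS
    fun_prop
  · intro j
    set z := TopologicalSpace.denseSeq (Vec n) j
    have hφ := (hdiff.hasDerivAt.norm_sub_sq_div_two z).sub (hder j (by rwa [uIcc_of_le hT]))
    -- The integrated inequality says exactly that this difference is nonincreasing; its derivative
    -- at `t` is therefore nonpositive.
    have hanti : AntitoneOn (fun r => ‖x r - z‖ ^ 2 / 2 -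
        ∫ q in (0 : ℝ)..r, eviRHS R b z (u q) (x q) (x q)) (Ioo 0 T) := by
      intro r hr s hs hrs
      have h2 := hevi z r s hr.1.le hrs hs.2.le
      have h3 := intervalIntegral.integral_add_adjacent_intervals
        ((hint z).mono_set (c := 0) (d := r)
          (by rw [uIcc_of_le hT, uIcc_of_le hr.1.le]; exact Icc_subset_Icc_right hr.2.le))
        ((hint z).mono_set (c := r) (d := s)
          (by rw [uIcc_of_le hT, uIcc_of_le hrs]; exact Icc_subset_Icc hr.1.le hs.2.le))
      dsimp only
      linarith
    have h4 := hanti.derivWithin_nonpos (x := t)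
    rw [derivWithin_of_isOpen isOpen_Ioo htIoo] at h4
    have h5 := hφ.deriv
    have h6 : deriv (fun r => ‖x r - z‖ ^ 2 / 2 -
        ∫ q in (0 : ℝ)..r, eviRHS R b z (u q) (x q) (x q)) t = _ := h5
    linarith

/-- The integrated evolution variational inequality for interpolated network states. -/
theorem interpolant_evi {m n : ℕ} {T : ℝ} (hT : 0 < T) {R : Vec n → ℝ}
    {b : Vec m} {x0 : Vec n} {N : ℕ} {V : Fin N → Param m n}
    (hV : ∀ k, 0 ≤ (V k).step ∧ 0 ≤ (V k).reg) {X : Fin (N + 1) → Vec n}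
    (hX : IsNetworkState T R b x0 V X) {K : ℝ≥0}
    (hK : ∀ k : Fin N, ‖X k.succ - X k.castSucc‖ ≤ K * (T / N)) (z : Vec n) {s t : ℝ} (hs : 0 ≤ s)
    (hst : s ≤ t) (ht : t ≤ T)
    (hint : IntervalIntegrable (fun r => eviRHS R b z (stepFun T N V r)
      (stepFun T N (fun k => X k.castSucc) r) (stepFun T N (fun k => X k.succ) r)) volume s t) :
    ‖interpolant T N X t - z‖ ^ 2 / 2 - ‖interpolant T N X s - z‖ ^ 2 / 2
      ≤ (∫ r in s..t, eviRHS R b z (stepFun T N V r)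
          (stepFun T N (fun k => X k.castSucc) r) (stepFun T N (fun k => X k.succ) r))
        + (t - s) * (K * (K * (T / N))) := by
  rcases N.eq_zero_or_pos with rfl | hN
  · simp [interpolant, stepFun, eviRHS, gradTerm, Param.step]
  have hconst : IntervalIntegrable (fun _ : ℝ => (K : ℝ) * (K * (T / N))) volume s t :=
    intervalIntegrable_const
  rw [← smul_eq_mul (t - s), ← intervalIntegral.integral_const,
    ← intervalIntegral.integral_add hint hconst]
  have hlip : LipschitzWith K fun r => interpolant T N X r - z := by
    have := lipschitzWith_interpolant hT hK
    exact LipschitzWith.of_dist_le_mul fun a c => by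
      rw [dist_sub_right]; exact this.dist_le_mul a c
  refine AbsolutelyContinuousOnInterval.sub_le_integral
    (φ := fun r => ‖interpolant T N X r - z‖ ^ 2 / 2) hst
    (hlip.lipschitzOnWith.absolutelyContinuousOnInterval.norm_sq_div_two) (hint.add hconst) ?_
  have hleb := _root_.LocallyIntegrable.ae_hasDerivAt_integral (locallyIntegrable_stepFun hT
    (fun k : Fin N => (T / N)⁻¹ • (X k.succ - X k.castSucc)))
  filter_upwards [ae_restrict_mem measurableSet_Icc, ae_restrict_of_ae hleb] with r hr hder
  have hd : HasDerivAt (interpolant T N X) _ r := (hder 0).const_add (X 0)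
  refine ⟨_, hd.norm_sub_sq_div_two z, ?_⟩
  obtain ⟨k, hk⟩ := exists_mem_cell hT hN (Icc_subset_Icc hs ht hr)
  simp only [stepFun_of_mem hT _ hk]
  have h1 := inner_difference_quotient_le hT hV hX z k
  -- The discrete inequality is stated at the right node. Moving to the interpolated point costs
  -- slope `K` times distance `K * (T / N)`.
  have h2 : ⟪(T / N)⁻¹ • (X k.succ - X k.castSucc), interpolant T N X r - X k.succ⟫
      ≤ K * (K * (T / N)) := by
    refine (real_inner_le_norm _ _).trans ?_
    gcongr
    · exact norm_difference_quotient_le hT hK k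
    · exact norm_interpolant_sub_succ_le hT hK hk
  have h3 : interpolant T N X r - z = (X k.succ - z) + (interpolant T N X r - X k.succ) := by abel
  rw [h3, inner_add_right]
  linarith

/-! ### Compactness of network states -/

theorem exists_subseq_tendsto_of_lipschitz {n : ℕ} {T : ℝ} (hT : 0 ≤ T) {K : ℝ≥0} {B : ℝ}
    {f : ℕ → ℝ → Vec n} (hf : ∀ i, LipschitzWith K (f i)) (hB : ∀ i, ∀ t ∈ Icc 0 T, ‖f i t‖ ≤ B) :
    ∃ φ : ℕ → ℕ, StrictMono φ ∧ ∃ x : ℝ → Vec n, LipschitzWith K x ∧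
      ∀ t ∈ Icc 0 T, Tendsto (fun i => f (φ i) t) atTop (𝓝 (x t)) := by
  let F : ℕ → BoundedContinuousFunction (Icc 0 T) (Vec n) := fun i =>
    BoundedContinuousFunction.mkOfCompact ⟨fun t => f i t, (hf i).continuous.comp continuous_subtype_val⟩
  have hcomp : IsCompact (closure (range F)) := by
    refine BoundedContinuousFunction.arzela_ascoli (Metric.closedBall (0 : Vec n) B)
      (isCompact_closedBall _ _) (range F) ?_ ?_
    · rintro _ t ⟨i, rfl⟩
      exact mem_closedBall_zero_iff.2 (hB i t t.2)
    · refine (LipschitzWith.uniformEquicontinuous (fun g : range F => (g : Icc 0 T → Vec n)) K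
        ?_).equicontinuous
      rintro ⟨_, i, rfl⟩
      exact LipschitzWith.of_dist_le_mul fun s t => (hf i).dist_le_mul s t
  obtain ⟨g, -, φ, hφ, hg⟩ := hcomp.tendsto_subseq (fun i => subset_closure (mem_range_self i))
  have hpt : ∀ t : Icc 0 T, Tendsto (fun i => f (φ i) t) atTop (𝓝 (g t)) := fun t =>
    ((continuous_eval_const (F := BoundedContinuousFunction (Icc 0 T) (Vec n)) t).tendsto g).comp hg
  -- Extending by the endpoint values keeps the constant `K`, because projection onto `[0,T]` is
  -- 1-Lipschitz.
  refine ⟨φ, hφ, IccExtend hT g, ?_, fun t ht => ?_⟩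
  · refine LipschitzWith.of_dist_le_mul fun s t => ?_
    refine le_of_tendsto ((hpt (projIcc 0 T hT s)).dist (hpt (projIcc 0 T hT t))) ?_
    filter_upwards with i
    refine ((hf (φ i)).dist_le_mul _ _).trans ?_
    gcongr
    have h := (LipschitzWith.projIcc hT).dist_le_mul s t
    rwa [NNReal.coe_one, one_mul] at h
  · rw [IccExtend_of_mem hT _ ht]
    exact hpt ⟨t, ht⟩

/-- Stability of the dynamics, used for the optimal parameters and again for the averages of a
competitor. -/
theorem exists_trajectory_of_tendsto {m n : ℕ} {T : ℝ} (hT : 0 < T) {R : Vec n → ℝ}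
    (hR : ConvexOn ℝ univ R) (h0 : (0 : Vec n) ∈ subdifferential R 0)
    (hgrowth : ∃ M : ℝ, 0 < M ∧ ∀ x, (∀ z ∈ subdifferential R x, ‖z‖ ≤ M * ‖x‖) ∨
      (∀ z ∈ subdifferential R x, ‖z‖ ≤ M)) {b : Vec m} {x0 : Vec n} {C : ℝ} (hC : 0 ≤ C)
    {N : ℕ → ℕ} (hN : ∀ i, 0 < N i) (hNtop : Tendsto N atTop atTop)
    {V : ∀ i, Fin (N i) → Param m n} (hV : ∀ i k, 0 ≤ (V i k).step ∧ 0 ≤ (V i k).reg)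
    (hVC : ∀ i k, ‖V i k‖ ≤ C) {p : ℝ≥0∞} {u : Control m n T p}
    (hu : ∀ᵐ t ∂(timeMeasure T), 0 ≤ (u t).step ∧ 0 ≤ (u t).reg)
    (hlim : ∀ᵐ t ∂(timeMeasure T), Tendsto (fun i => stepFun T (N i) (V i) t) atTop (𝓝 (u t)))
    {X : ∀ i, Fin (N i + 1) → Vec n} (hX : ∀ i, IsNetworkState T R b x0 (V i) (X i)) :
    ∃ φ : ℕ → ℕ, StrictMono φ ∧ ∃ x, IsTrajectory R b x0 u x ∧
      Tendsto (fun i => X (φ i) (Fin.last _)) atTop (𝓝 (x T)) := by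
  have hRc : Continuous R := hR.locallyLipschitz.continuous
  obtain ⟨B, K, hBK⟩ := exists_networkState_bounds hT h0 hgrowth b x0 hC
  have hB : ∀ i k, ‖X i k‖ ≤ B := fun i => (hBK _ _ (hV i) (hVC i) _ (hX i)).1
  have hK : ∀ i, ∀ k : Fin (N i), ‖X i k.succ - X i k.castSucc‖ ≤ K * (T / N i) :=
    fun i => (hBK _ _ (hV i) (hVC i) _ (hX i)).2
  have hlip : ∀ i, LipschitzWith K (interpolant T (N i) (X i)) :=
    fun i => lipschitzWith_interpolant hT (hK i)
  obtain ⟨φ, hφ, x, hxlip, hx⟩ := exists_subseq_tendsto_of_lipschitz hT.le hlip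
    (B := ‖x0‖ + K * T) (fun i t ht => by
      have h1 := (hlip i).dist_le_mul t 0
      rw [interpolant_zero, (hX i).1, Real.dist_eq, sub_zero, abs_of_nonneg ht.1, dist_eq_norm] at h1
      have h2 := norm_le_norm_add_norm_sub' (interpolant T (N i) (X i) t) x0
      have h3 : (K : ℝ) * t ≤ K * T := by gcongr; exact ht.2
      linarith)
  have hstep : Tendsto (fun i => (K : ℝ) * (T / N (φ i))) atTop (𝓝 0) := by
    have h1 : Tendsto (fun i => ((N (φ i) : ℕ) : ℝ)) atTop atTop :=
      tendsto_natCast_atTop_atTop.comp (hNtop.comp hφ.tendsto_atTop)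
    simpa using (h1.const_div_atTop T).const_mul (K : ℝ)
  -- Left and right node states both lie within `K * (T / N)` of the interpolant, so they share its
  -- limit.
  have hnear : ∀ t ∈ Icc 0 T, ∀ w : ℕ → Vec n,
      (∀ i, ‖interpolant T (N (φ i)) (X (φ i)) t - w i‖ ≤ K * (T / N (φ i))) →
      Tendsto w atTop (𝓝 (x t)) := by
    intro t ht w hw
    have h1 := squeeze_zero_norm hw hstep
    simpa using (hx t ht).sub h1
  have hXm : ∀ t ∈ Icc 0 T, Tendsto
      (fun i => stepFun T (N (φ i)) (fun k => X (φ i) k.castSucc) t) atTop (𝓝 (x t)) := by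
    refine fun t ht => hnear t ht _ fun i => ?_
    obtain ⟨k, hk⟩ := exists_mem_cell hT (hN (φ i)) ht
    rw [stepFun_of_mem hT _ hk]
    exact norm_interpolant_sub_castSucc_le hT (hK _) hk
  have hXp : ∀ t ∈ Icc 0 T, Tendsto
      (fun i => stepFun T (N (φ i)) (fun k => X (φ i) k.succ) t) atTop (𝓝 (x t)) := by
    refine fun t ht => hnear t ht _ fun i => ?_
    obtain ⟨k, hk⟩ := exists_mem_cell hT (hN (φ i)) ht
    rw [stepFun_of_mem hT _ hk]
    exact norm_interpolant_sub_succ_le hT (hK _) hk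
  let G : Vec n → ℕ → ℝ → ℝ := fun z i r => eviRHS R b z (stepFun T (N (φ i)) (V (φ i)) r)
    (stepFun T (N (φ i)) (fun k => X (φ i) k.castSucc) r)
    (stepFun T (N (φ i)) (fun k => X (φ i) k.succ) r)
  have hGmeas : ∀ z i, StronglyMeasurable (G z i) := fun z i =>
    (continuous_eviRHS hRc b z).comp_stronglyMeasurable
      ((stronglyMeasurable_stepFun _).prodMk
        ((stronglyMeasurable_stepFun _).prodMk (stronglyMeasurable_stepFun _)))
  have hGlim : ∀ z, ∀ᵐ t ∂(timeMeasure T), Tendsto (fun i => G z i t) atTop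
      (𝓝 (eviRHS R b z (u t) (x t) (x t))) := by
    intro z
    filter_upwards [hlim, ae_restrict_mem measurableSet_Icc] with t ht htI
    exact tendsto_eviRHS hRc b z (ht.comp hφ.tendsto_atTop) (hXm t htI) (hXp t htI)
  have hGbd : ∀ z, ∃ c : ℝ, ∀ i r, ‖G z i r‖ ≤ c := by
    intro z
    obtain ⟨c, hc⟩ := exists_bound_eviRHS hRc b z C B
    exact ⟨c, fun i r => hc _ _ _ (norm_stepFun_le hT hC (hVC _) r)
      (norm_stepFun_le hT B.2 (fun k => hB _ _) r) (norm_stepFun_le hT B.2 (fun k => hB _ _) r)⟩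
  have hGint : ∀ z i s t, IntervalIntegrable (G z i) volume s t := by
    intro z i s t
    obtain ⟨c, hc⟩ := hGbd z
    exact (intervalIntegrable_const (c := c)).mono_fun' (hGmeas z i).aestronglyMeasurable
      (Eventually.of_forall fun r => hc i r)
  have hLmeas : ∀ z, AEStronglyMeasurable (fun t => eviRHS R b z (u t) (x t) (x t))
      (timeMeasure T) := fun z =>
    aestronglyMeasurable_of_tendsto_ae atTop (fun i => (hGmeas z i).aestronglyMeasurable) (hGlim z)
  have hLint : ∀ z, IntervalIntegrable (fun t => eviRHS R b z (u t) (x t) (x t)) volume 0 T := by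
    intro z
    obtain ⟨c, hc⟩ := hGbd z
    rw [intervalIntegrable_iff_integrableOn_Icc_of_le hT.le]
    refine (integrable_const c).mono' (hLmeas z) ?_
    filter_upwards [hGlim z] with t ht
    exact le_of_tendsto ht.norm (Eventually.of_forall fun i => hc i t)
  refine ⟨φ, hφ, x, ⟨hxlip.lipschitzOnWith.absolutelyContinuousOnInterval, ?_, ?_⟩, ?_⟩
  · refine tendsto_nhds_unique (hx 0 ⟨le_rfl, hT.le⟩) ?_
    simp only [interpolant_zero, (hX _).1]
    exact tendsto_const_nhds
  · refine ae_inclusion_of_evi hR hu hxlip hLint fun z s t hs hst ht => ?_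
    obtain ⟨c, hc⟩ := hGbd z
    have hI : Tendsto (fun i => ∫ r in s..t, G z i r) atTop
        (𝓝 (∫ r in s..t, eviRHS R b z (u r) (x r) (x r))) := by
      refine intervalIntegral.tendsto_integral_filter_of_dominated_convergence (fun _ => c)
        (Eventually.of_forall fun i => (hGmeas z i).aestronglyMeasurable)
        (Eventually.of_forall fun i => Eventually.of_forall fun r _ => hc i r)
        intervalIntegrable_const ?_
      filter_upwards [(ae_restrict_iff' measurableSet_Icc).1 (hGlim z)] with r hr hmem
      rw [uIoc_of_le hst] at hmem
      exact hr ⟨hs.trans hmem.1.le, hmem.2.trans ht⟩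
    have hE : Tendsto (fun i => (t - s) * ((K : ℝ) * (K * (T / N (φ i))))) atTop (𝓝 0) := by
      simpa using (hstep.const_mul (K : ℝ)).const_mul (t - s)
    have hL := (((hx t ⟨hs.trans hst, ht⟩).sub_const z).norm.pow 2).div_const 2
    have hL' := (((hx s ⟨hs, hst.trans ht⟩).sub_const z).norm.pow 2).div_const 2
    have hRt := hI.add hE
    rw [add_zero] at hRt
    exact le_of_tendsto_of_tendsto' (hL.sub hL') hRt fun i =>
      interpolant_evi hT (hV _) (hX _) (hK _) z hs hst ht (hGint z i s t)
  · have := hx T ⟨hT.le, le_rfl⟩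
    simpa only [interpolant_end hT (hN _)] using this

/-- Trajectories are determined by the control. -/
theorem IsTrajectory.eq_at_end {m n : ℕ} {T : ℝ} (hT : 0 < T) {R : Vec n → ℝ} {b : Vec m}
    {x0 : Vec n} {p : ℝ≥0∞} {u : Control m n T p}
    (hu : ∀ᵐ t ∂(timeMeasure T), 0 ≤ (u t).step ∧ 0 ≤ (u t).reg) {x z : ℝ → Vec n}
    (hx : IsTrajectory R b x0 u x) (hz : IsTrajectory R b x0 u z) : x T = z T := by
  have hac : AbsolutelyContinuousOnInterval (fun t => x t - z t) 0 T := hx.1.sub hz.1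
  -- By monotonicity, half the squared distance has nonpositive derivative a.e., and it starts at
  -- zero.
  have h := hac.norm_sq_div_two.sub_le_integral hT.le (G := fun _ => 0) intervalIntegrable_const ?_
  · simp only [hx.2.1, hz.2.1, intervalIntegral.integral_zero, sub_self, norm_zero] at h
    have h1 : ‖x T - z T‖ = 0 := by nlinarith [norm_nonneg (x T - z T)]
    exact sub_eq_zero.1 (norm_eq_zero.1 h1)
  · filter_upwards [hu, hx.2.2, hz.2.2] with t hut ⟨v, hv, g, hg, hgv⟩ ⟨w, hw, k, hk, hkw⟩
    refine ⟨_, (by simpa using (hv.sub hw).norm_sub_sq_div_two 0), ?_⟩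
    have h1 := inner_gradTerm_sub_nonneg b hut.1 (x t) (z t)
    have h2 := mul_nonneg (mul_nonneg hut.1 hut.2) (inner_sub_nonneg_of_mem_subdifferential hg hk)
    have h3 : v - w = -(gradTerm b (u t) (x t) - gradTerm b (u t) (z t))
        - ((u t).step * (u t).reg) • (g - k) := by
      rw [← sub_eq_zero, smul_sub]
      calc _ = (v + gradTerm b (u t) (x t) + ((u t).step * (u t).reg) • g)
            - (w + gradTerm b (u t) (z t) + ((u t).step * (u t).reg) • k) := by abel
        _ = 0 := by rw [hgv, hkw, sub_zero]
    rw [h3, inner_sub_left, inner_neg_left, real_inner_smul_left]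
    linarith

/-! ### Averages -/

section Average

variable {m n : ℕ} {T : ℝ} {p : ℝ≥0∞}

theorem coeFn_extend {N : ℕ} (V : Fin N → Param m n) :
    extend T p V =ᵐ[timeMeasure T] stepFun T N V :=
  MemLp.coeFn_toLp _

theorem BoundedInLinfty.exists_ae_norm_le {D : Set (Control m n T p)} (hD : BoundedInLinfty D) :
    ∃ C : ℝ, 0 ≤ C ∧ ∀ u ∈ D, ∀ᵐ t ∂(timeMeasure T), ‖u t‖ ≤ C := by
  obtain ⟨C, hC⟩ := hD
  refine ⟨C, C.2, fun u hu => ?_⟩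
  have h := hC u hu
  rw [eLpNorm_exponent_top] at h
  filter_upwards [ae_le_eLpNormEssSup (f := (u : ℝ → Param m n)) (μ := timeMeasure T)] with t ht
  have h1 : ‖u t‖ₑ ≤ C := ht.trans h
  exact_mod_cast enorm_le_coe.1 h1

theorem toReal_volume_cell (hT : 0 < T) {N : ℕ} (k : Fin N) :
    (volume (cell T N k)).toReal = T / N := by
  rw [volume_cell hT, ENNReal.toReal_ofReal (by positivity)]

theorem norm_average_le (hT : 0 < T) {C : ℝ} {u : Control m n T p}
    (hu : ∀ᵐ t ∂(timeMeasure T), ‖u t‖ ≤ C) {N : ℕ} (k : Fin N) : ‖average N u k‖ ≤ C := by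
  have hN : (0 : ℝ) < N := Nat.cast_pos.2 k.pos
  have hh : 0 < T / N := by positivity
  unfold average
  rw [toReal_volume_cell hT, norm_smul, norm_inv, Real.norm_eq_abs, abs_of_pos hh,
    inv_mul_le_iff₀ hh, mul_comm]
  have h := norm_setIntegral_le_of_norm_le_const_ae (μ := volume) (s := cell T N k)
    (f := (u : ℝ → Param m n)) (C := C) (by rw [volume_cell hT]; exact ENNReal.ofReal_lt_top)
    (ae_mono (Measure.restrict_mono (cell_subset_Icc hT k) le_rfl) hu)
  rwa [measureReal_def, toReal_volume_cell hT] at h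

theorem integrableOn_cell [Fact (1 ≤ p)] (hT : 0 < T) (u : Control m n T p) {N : ℕ} (k : Fin N) :
    IntegrableOn u (cell T N k) := by
  have h : IntegrableOn u (Icc 0 T) := (Lp.memLp u).integrable Fact.out
  exact h.mono_set (cell_subset_Icc hT k)

theorem average_nonneg [Fact (1 ≤ p)] (hT : 0 < T) {u : Control m n T p}
    (hu : ∀ᵐ t ∂(timeMeasure T), 0 ≤ (u t).step ∧ 0 ≤ (u t).reg) {N : ℕ} (k : Fin N) :
    0 ≤ (average N u k).step ∧ 0 ≤ (average N u k).reg := by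
  have hu' := ae_mono (Measure.restrict_mono (cell_subset_Icc hT k) le_rfl) hu
  have h1 : 0 ≤ Param.stepL (average N u k) := by
    unfold average
    rw [map_smul, ← Param.stepL.integral_comp_comm (integrableOn_cell hT u k)]
    refine smul_nonneg (by positivity) (integral_nonneg_of_ae ?_)
    filter_upwards [hu'] with t ht using ht.1
  have h2 : 0 ≤ Param.regL (average N u k) := by
    unfold average
    rw [map_smul, ← Param.regL.integral_comp_comm (integrableOn_cell hT u k)]
    refine smul_nonneg (by positivity) (integral_nonneg_of_ae ?_)
    filter_upwards [hu'] with t ht using ht.2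
  exact ⟨h1, h2⟩

/-! ### Approximation by averages -/

/-- Jensen's inequality, obtained from monotonicity of `L^p` norms in the exponent on a probability
space. -/
theorem _root_.MeasureTheory.enorm_integral_rpow_le {α E : Type*} [MeasurableSpace α]
    [NormedAddCommGroup E] [NormedSpace ℝ E] {ν : Measure α} [IsProbabilityMeasure ν] {g : α → E}
    (hg : AEStronglyMeasurable g ν) {p : ℝ≥0∞} (hp1 : 1 ≤ p) (hp : p ≠ ∞) :
    ‖∫ x, g x ∂ν‖ₑ ^ p.toReal ≤ ∫⁻ x, ‖g x‖ₑ ^ p.toReal ∂ν := by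
  have hp0 : p ≠ 0 := (zero_lt_one.trans_le hp1).ne'
  have hq : 0 < p.toReal := ENNReal.toReal_pos hp0 hp
  have h1 : ‖∫ x, g x ∂ν‖ₑ ≤ eLpNorm g p ν :=
    (enorm_integral_le_lintegral_enorm g).trans
      (eLpNorm_one_eq_lintegral_enorm.symm.le.trans (eLpNorm_le_eLpNorm_of_exponent_le hp1 hg))
  calc ‖∫ x, g x ∂ν‖ₑ ^ p.toReal ≤ eLpNorm g p ν ^ p.toReal := by gcongr
    _ = ∫⁻ x, ‖g x‖ₑ ^ p.toReal ∂ν := by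
      rw [eLpNorm_eq_lintegral_rpow_enorm_toReal hp0 hp, ← ENNReal.rpow_mul,
        one_div_mul_cancel hq.ne', ENNReal.rpow_one]

theorem stronglyMeasurable_zeroExtend (u : Control m n T p) : StronglyMeasurable (zeroExtend u) :=
  (Lp.stronglyMeasurable u).indicator measurableSet_Icc

/-- The error at `t` is the mean of `u s - u t` over the cell of `t`. Apply Jensen, substitute `s =
t + h`, and enlarge the range of `h` to a window independent of `t`. -/
theorem enorm_stepFun_average_sub_rpow_le [Fact (1 ≤ p)] (hp : p ≠ ∞) (hT : 0 < T)
    (u : Control m n T p) {N : ℕ} (hN : 0 < N) {t : ℝ} (ht : t ∈ Icc 0 T) :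
    ‖stepFun T N (average N u) t - u t‖ₑ ^ p.toReal ≤ (ENNReal.ofReal (T / N))⁻¹ *
      ∫⁻ h in Icc (-(T / N)) (T / N), ‖zeroExtend u (t + h) - zeroExtend u t‖ₑ ^ p.toReal := by
  have hN' : (0 : ℝ) < N := Nat.cast_pos.2 hN
  have hh : 0 < T / N := by positivity
  obtain ⟨k, hk⟩ := exists_mem_cell hT hN ht
  have hvol : volume (cell T N k) = ENNReal.ofReal (T / N) := volume_cell hT k
  have hvol0 : volume (cell T N k) ≠ 0 := by
    rw [hvol]; exact (ENNReal.ofReal_pos.2 hh).ne'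
  have hvolt : volume (cell T N k) ≠ ∞ := by rw [hvol]; exact ENNReal.ofReal_ne_top
  set ν : Measure ℝ := (volume (cell T N k))⁻¹ • volume.restrict (cell T N k) with hν
  have : IsProbabilityMeasure ν := ⟨by
    rw [hν, Measure.smul_apply, Measure.restrict_apply_univ, smul_eq_mul,
      ENNReal.inv_mul_cancel hvol0 hvolt]⟩
  have hint : Integrable u ν :=
    (integrableOn_cell hT u k).smul_measure (ENNReal.inv_ne_top.2 hvol0)
  have hmean : stepFun T N (average N u) t - u t = ∫ s, (u s - u t) ∂ν := by
    rw [stepFun_of_mem hT _ hk, integral_sub hint (integrable_const _), integral_const, hν,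
      integral_smul_measure, ENNReal.toReal_inv, average, ← hν]
    simp
  rw [hmean]
  refine (enorm_integral_rpow_le (hint.1.sub aestronglyMeasurable_const) Fact.out hp).trans ?_
  rw [hν, lintegral_smul_measure, hvol, smul_eq_mul]
  gcongr 1
  rw [← lintegral_indicator (measurableSet_cell T N k), ← lintegral_indicator measurableSet_Icc,
    ← lintegral_add_left_eq_self _ t]
  refine lintegral_mono fun h => ?_
  by_cases hmem : t + h ∈ cell T N k
  · have h1 := abs_le.1 (sub_mem_cell_le hmem hk)
    rw [indicator_of_mem hmem, indicator_of_mem (show h ∈ Icc _ _ from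
      ⟨by linarith [h1.1], by linarith [h1.2]⟩), zeroExtend, indicator_of_mem ht,
      indicator_of_mem (cell_subset_Icc hT k hmem), Pi.sub_apply]
  · rw [indicator_of_notMem hmem]
    exact zero_le

theorem eLpNorm_stepFun_average_sub_le [Fact (1 ≤ p)] (hp : p ≠ ∞) (hT : 0 < T)
    (u : Control m n T p) {N : ℕ} (hN : 0 < N) {ε : ℝ≥0∞}
    (hu : ∀ h, |h| ≤ T / N → eLpNorm (fun t => zeroExtend u (t + h) - zeroExtend u t) p volume ≤ ε) :
    eLpNorm (fun t => stepFun T N (average N u) t - u t) p (timeMeasure T) ≤ 2 * ε := by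
  have hp1 : 1 ≤ p := Fact.out
  have hp0 : p ≠ 0 := (zero_lt_one.trans_le hp1).ne'
  have hq : 1 ≤ p.toReal := by
    rw [← ENNReal.toReal_one]; exact ENNReal.toReal_mono hp hp1
  have hq0 : 0 < p.toReal := by linarith
  have hN' : (0 : ℝ) < N := Nat.cast_pos.2 hN
  have hh : 0 < T / N := by positivity
  have hc0 : ENNReal.ofReal (T / N) ≠ 0 := (ENNReal.ofReal_pos.2 hh).ne'
  have hmeas := stronglyMeasurable_zeroExtend u
  have hjoint : Measurable fun q : ℝ × ℝ =>
      ‖zeroExtend u (q.1 + q.2) - zeroExtend u q.1‖ₑ ^ p.toReal :=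
    (((hmeas.comp_measurable (measurable_fst.add measurable_snd)).sub
      (hmeas.comp_measurable measurable_fst)).enorm).pow_const _
  rw [eLpNorm_eq_lintegral_rpow_enorm_toReal hp0 hp, one_div, ENNReal.rpow_inv_le_iff hq0]
  calc ∫⁻ t in Icc 0 T, ‖stepFun T N (average N u) t - u t‖ₑ ^ p.toReal
      ≤ ∫⁻ t in Icc 0 T, (ENNReal.ofReal (T / N))⁻¹ * ∫⁻ h in Icc (-(T / N)) (T / N),
          ‖zeroExtend u (t + h) - zeroExtend u t‖ₑ ^ p.toReal :=
        setLIntegral_mono' measurableSet_Icc fun t ht =>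
          enorm_stepFun_average_sub_rpow_le hp hT u hN ht
    _ ≤ ∫⁻ t, (ENNReal.ofReal (T / N))⁻¹ * ∫⁻ h in Icc (-(T / N)) (T / N),
          ‖zeroExtend u (t + h) - zeroExtend u t‖ₑ ^ p.toReal := setLIntegral_le_lintegral _ _
    _ = (ENNReal.ofReal (T / N))⁻¹ * ∫⁻ h in Icc (-(T / N)) (T / N), ∫⁻ t,
          ‖zeroExtend u (t + h) - zeroExtend u t‖ₑ ^ p.toReal := by
        rw [lintegral_const_mul' _ _ (ENNReal.inv_ne_top.2 hc0)]
        congr 1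
        exact lintegral_lintegral_swap hjoint.aemeasurable
    _ ≤ (ENNReal.ofReal (T / N))⁻¹ * ∫⁻ h in Icc (-(T / N)) (T / N), ε ^ p.toReal := by
        gcongr 1
        refine setLIntegral_mono' measurableSet_Icc fun h hh' => ?_
        have h1 := hu h (abs_le.2 hh')
        rwa [eLpNorm_eq_lintegral_rpow_enorm_toReal hp0 hp, one_div,
          ENNReal.rpow_inv_le_iff hq0] at h1
    -- The window has length `2 * (T / N)` against the normalization `(T / N)⁻¹`; the factor 2 is
    -- then absorbed using `2 ≤ 2 ^ p`.
    _ = 2 * ε ^ p.toReal := by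
        rw [setLIntegral_const, Real.volume_Icc, sub_neg_eq_add, ← two_mul,
          ENNReal.ofReal_mul zero_le_two, ENNReal.ofReal_ofNat, mul_comm (ε ^ _), ← mul_assoc,
          mul_left_comm, ENNReal.inv_mul_cancel hc0 ENNReal.ofReal_ne_top, mul_one]
    _ ≤ (2 * ε) ^ p.toReal := by
        rw [ENNReal.mul_rpow_of_nonneg _ _ hq0.le]
        gcongr
        exact ENNReal.le_rpow_self_of_one_le one_le_two hq

theorem TranslationEquicontinuous.exists_dist_extend_average_le [Fact (1 ≤ p)] (hp : p ≠ ∞)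
    (hT : 0 < T) {D : Set (Control m n T p)} (hD : TranslationEquicontinuous D) {ε : ℝ}
    (hε : 0 < ε) : ∃ N₀ : ℕ, ∀ N, N₀ ≤ N → 0 < N → ∀ u ∈ D, dist (extend T p (average N u)) u ≤ ε := by
  obtain ⟨δ, hδ, hDδ⟩ := hD (ε / 2) (by positivity)
  obtain ⟨N₀, hN₀⟩ := exists_nat_gt (T / δ)
  refine ⟨N₀, fun N hN hNpos u hu => ?_⟩
  have hN' : (0 : ℝ) < N := Nat.cast_pos.2 hNpos
  have hlt : T / N < δ := by
    rw [div_lt_iff₀ hN', mul_comm, ← div_lt_iff₀ hδ]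
    exact hN₀.trans_le (by exact_mod_cast hN)
  have h := eLpNorm_stepFun_average_sub_le hp hT u hNpos
    (fun h hh => (hDδ h (hh.trans_lt hlt) u hu).le)
  rw [dist_edist, Lp.edist_def]
  refine ENNReal.toReal_le_of_le_ofReal hε.le ?_
  rw [eLpNorm_congr_ae (g := fun t => stepFun T N (average N u) t - u t)]
  · refine h.trans_eq ?_
    rw [← ENNReal.ofReal_ofNat, ← ENNReal.ofReal_mul zero_le_two, mul_div_cancel₀ _ two_ne_zero]
  · filter_upwards [coeFn_extend (T := T) (p := p) (average N u)] with t ht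
    rw [Pi.sub_apply, ht]

theorem TranslationEquicontinuous.tendsto_extend_average [Fact (1 ≤ p)] (hp : p ≠ ∞) (hT : 0 < T)
    {D : Set (Control m n T p)} (hD : TranslationEquicontinuous D) {u : Control m n T p}
    (hu : u ∈ D) {N : ℕ → ℕ} (hN : ∀ i, 0 < N i) (hNtop : Tendsto N atTop atTop) :
    Tendsto (fun i => extend T p (average (N i) u)) atTop (𝓝 u) := by
  rw [Metric.tendsto_nhds]
  intro ε hε
  obtain ⟨N₀, hN₀⟩ := hD.exists_dist_extend_average_le hp hT (half_pos hε)
  filter_upwards [hNtop.eventually_ge_atTop N₀] with i hi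
  exact (hN₀ (N i) hi (hN i) u hu).trans_lt (half_lt_self hε)

/-! ### Compactness in `L^p` and a.e. convergent subsequences -/

theorem stepFun_sub {X : Type*} [AddCommGroup X] {N : ℕ} (V W : Fin N → X) (t : ℝ) :
    stepFun T N V t - stepFun T N W t = stepFun T N (V - W) t := by
  unfold stepFun
  rw [← Finset.sum_sub_distrib]
  exact Finset.sum_congr rfl fun k _ => (congrFun (indicator_sub _ _ _) t).symm

theorem continuous_extend [Fact (1 ≤ p)] (hT : 0 < T) (N : ℕ) :
    Continuous (extend T p : (Fin N → Param m n) → Control m n T p) := by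
  refine (LipschitzWith.of_dist_le_mul
    (K := measureUnivNNReal (timeMeasure T) ^ p.toReal⁻¹) fun V W => ?_).continuous
  rw [dist_eq_norm, dist_eq_norm]
  refine (Lp.norm_le_of_ae_bound (norm_nonneg (V - W)) ?_).trans_eq (by simp)
  filter_upwards [Lp.coeFn_sub (extend T p V) (extend T p W), coeFn_extend (T := T) (p := p) V,
    coeFn_extend (T := T) (p := p) W] with t h1 h2 h3
  rw [h1, Pi.sub_apply, h2, h3, stepFun_sub]
  exact norm_stepFun_le hT (norm_nonneg _) (norm_le_pi_norm (V - W)) t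

/-- A version of the Kolmogorov–Riesz compactness theorem. -/
theorem isCompact_of_translationEquicontinuous [Fact (1 ≤ p)] (hp : p ≠ ∞) (hT : 0 < T)
    {D : Set (Control m n T p)} (hbdd : BoundedInLinfty D) (hclosed : IsClosed D)
    (hequi : TranslationEquicontinuous D) : IsCompact D := by
  refine TotallyBounded.isCompact_of_isClosed ?_ hclosed
  have : FiniteDimensional ℝ (Param m n) := inferInstance
  have : ProperSpace (Param m n) := FiniteDimensional.proper_real _
  obtain ⟨C, hC, hDC⟩ := hbdd.exists_ae_norm_le
  rw [Metric.totallyBounded_iff]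
  intro ε hε
  obtain ⟨N₀, hN₀⟩ := hequi.exists_dist_extend_average_le hp hT (half_pos hε)
  set N := N₀ + 1
  -- At one sufficiently fine level all averages lie in a finite-dimensional ball. Its compact image
  -- is within `ε / 2` of every element of `D`.
  have hK : IsCompact (extend T p '' Metric.closedBall (0 : Fin N → Param m n) C) :=
    (isCompact_closedBall _ _).image (continuous_extend hT N)
  obtain ⟨t, ht, hcov⟩ := Metric.totallyBounded_iff.1 hK.totallyBounded (ε / 2) (half_pos hε)
  refine ⟨t, ht, fun u hu => ?_⟩
  have hmem : extend T p (average N u) ∈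
      extend T p '' Metric.closedBall (0 : Fin N → Param m n) C :=
    mem_image_of_mem _ (mem_closedBall_zero_iff.2
      ((pi_norm_le_iff_of_nonneg hC).2 (norm_average_le hT (hDC u hu))))
  obtain ⟨y, hy, hdist⟩ := mem_iUnion₂.1 (hcov hmem)
  refine mem_iUnion₂.2 ⟨y, hy, ?_⟩
  have h1 := hN₀ N (Nat.le_succ _) (Nat.succ_pos _) u hu
  rw [Metric.mem_ball] at hdist ⊢
  rw [dist_comm] at h1
  linarith [dist_triangle u (extend T p (average N u)) y]

theorem exists_subseq_ae_tendsto_stepFun [Fact (1 ≤ p)] {N : ℕ → ℕ} {V : ∀ i, Fin (N i) → Param m n}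
    {u : Control m n T p} (h : Tendsto (fun i => extend T p (V i)) atTop (𝓝 u)) :
    ∃ φ : ℕ → ℕ, StrictMono φ ∧ ∀ᵐ t ∂(timeMeasure T),
      Tendsto (fun i => stepFun T (N (φ i)) (V (φ i)) t) atTop (𝓝 (u t)) := by
  obtain ⟨φ, hφ, hlim⟩ := (tendstoInMeasure_of_tendsto_Lp h).exists_seq_tendsto_ae
  refine ⟨φ, hφ, ?_⟩
  have h1 : ∀ᵐ t ∂(timeMeasure T), ∀ i, extend T p (V i) t = stepFun T (N i) (V i) t :=
    ae_all_iff.2 fun i => coeFn_extend (V i)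
  filter_upwards [hlim, h1] with t ht ht1
  simpa only [ht1] using ht

/-! ### Convergence of costs -/

/-- The discrete mean equals the time mean along the step function, so dominated convergence
applies. -/
theorem tendsto_mean_comp {C : ℝ} (hC : 0 ≤ C) (hT : 0 < T) {N : ℕ → ℕ} (hN : ∀ i, 0 < N i)
    {V : ∀ i, Fin (N i) → Param m n} (hVC : ∀ i k, ‖V i k‖ ≤ C) {u : Control m n T p}
    (hlim : ∀ᵐ t ∂(timeMeasure T), Tendsto (fun i => stepFun T (N i) (V i) t) atTop (𝓝 (u t)))
    {F : Param m n → ℝ} (hF : Continuous F) :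
    Tendsto (fun i => (1 / (N i : ℝ)) * ∑ k, F (V i k)) atTop
      (𝓝 ((1 / T) * ∫ t in Icc 0 T, F (u t))) := by
  have : FiniteDimensional ℝ (Param m n) := inferInstance
  have : ProperSpace (Param m n) := FiniteDimensional.proper_real _
  obtain ⟨c, hc⟩ := (isCompact_closedBall (0 : Param m n) C).exists_bound_of_continuousOn
    hF.continuousOn
  have heq : ∀ i, (1 / (N i : ℝ)) * ∑ k, F (V i k)
      = (1 / T) * ∫ t in Icc 0 T, F (stepFun T (N i) (V i) t) := by
    intro i
    have hN' : (0 : ℝ) < N i := Nat.cast_pos.2 (hN i)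
    rw [integral_comp_stepFun hT (hN i)]
    field_simp
  simp only [heq]
  refine Tendsto.const_mul _ (tendsto_integral_of_dominated_convergence (fun _ => c)
    (fun i => (hF.comp_stronglyMeasurable (stronglyMeasurable_stepFun _)).aestronglyMeasurable)
    (integrable_const c) (fun i => Eventually.of_forall fun t => hc _ ?_) ?_)
  · exact mem_closedBall_zero_iff.2 (norm_stepFun_le hT hC (hVC i) t)
  · filter_upwards [hlim] with t ht using (hF.tendsto _).comp ht

theorem tendsto_networkCost {L : Vec n → Vec n → ℝ}
    (hL : Continuous fun q : Vec n × Vec n => L q.1 q.2) {ψ : ℝ → ℝ} (hψ : Continuous ψ)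
    (β₁ β₂ β₃ : ℝ) (y : Vec n) {C : ℝ} (hC : 0 ≤ C) (hT : 0 < T) {N : ℕ → ℕ} (hN : ∀ i, 0 < N i)
    {V : ∀ i, Fin (N i) → Param m n} (hVC : ∀ i k, ‖V i k‖ ≤ C) {u : Control m n T p}
    (hlim : ∀ᵐ t ∂(timeMeasure T), Tendsto (fun i => stepFun T (N i) (V i) t) atTop (𝓝 (u t)))
    {w : ℕ → Vec n} {x : Vec n} (hw : Tendsto w atTop (𝓝 x)) :
    Tendsto (fun i => networkCost p L ψ β₁ β₂ β₃ y (V i) (w i)) atTop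
      (𝓝 (controlCost L ψ β₁ β₂ β₃ y u x)) := by
  have hq : 0 ≤ p.toReal := ENNReal.toReal_nonneg
  have hmean := fun (F : Param m n → ℝ) (hF : Continuous F) =>
    (hψ.tendsto _).comp (tendsto_mean_comp hC hT hN hVC hlim hF)
  have hLw : Tendsto (fun i => L (w i) y) atTop (𝓝 (L x y)) :=
    (hL.tendsto (x, y)).comp (hw.prodMk_nhds tendsto_const_nhds)
  have h1 := hmean (fun v => ‖v.mat‖ ^ p.toReal)
    (Param.continuous_mat.norm.rpow_const fun _ => Or.inr hq)
  have h2 := hmean (fun v => |v.step| ^ p.toReal)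
    (Param.continuous_step.abs.rpow_const fun _ => Or.inr hq)
  have h3 := hmean (fun v => |v.reg| ^ p.toReal)
    (Param.continuous_reg.abs.rpow_const fun _ => Or.inr hq)
  exact ((hLw.add (h1.const_mul β₁)).add (h2.const_mul β₂)).add (h3.const_mul β₃)

end Average

end FBSNet

/-! ### Passage to the limit in the minimality inequality -/

theorem mainTheorem3 {m n : ℕ} (T : ℝ) (hT : 0 < T)
    (p : ℝ≥0∞) [Fact (1 ≤ p)] (hp : p ≠ ∞)
    (R : FBSNet.Vec n → ℝ) (L : FBSNet.Vec n → FBSNet.Vec n → ℝ) (ψ : ℝ → ℝ)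
    (β₁ β₂ β₃ : ℝ) (hβ₁ : 0 ≤ β₁) (hβ₂ : 0 ≤ β₂) (hβ₃ : 0 ≤ β₃)
    (b : FBSNet.Vec m) (x0 y : FBSNet.Vec n)
    (hA1 : ConvexOn ℝ univ R)
    (hA2 : (0 : FBSNet.Vec n) ∈ FBSNet.subdifferential R 0)
    (hA3 : ∃ M : ℝ, 0 < M ∧ ∀ x, (∀ z ∈ FBSNet.subdifferential R x, ‖z‖ ≤ M * ‖x‖) ∨
      (∀ z ∈ FBSNet.subdifferential R x, ‖z‖ ≤ M))
    (hA4 : Continuous (fun q : FBSNet.Vec n × FBSNet.Vec n => L q.1 q.2) ∧ ∀ x z, 0 ≤ L x z)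
    (hA5 : LocallyLipschitz ψ ∧ ∀ r, 0 ≤ ψ r)
    (D : Set (FBSNet.Control m n T p))
    (hDnonneg : ∀ u ∈ D, ∀ᵐ t ∂(FBSNet.timeMeasure T), 0 ≤ (u t).step ∧ 0 ≤ (u t).reg)
    (hDbdd : FBSNet.BoundedInLinfty D)
    (hDclosed : IsClosed D)
    (hDequi : FBSNet.TranslationEquicontinuous D)
    (hDproj : ∀ N : ℕ+, ∀ u ∈ D, FBSNet.extend T p (FBSNet.average (N : ℕ) u) ∈ D)
    (V : ∀ N : ℕ+, Fin N → FBSNet.Param m n)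
    (hV : ∀ N : ℕ+, FBSNet.SolvesNetworkProblem T p R L ψ β₁ β₂ β₃ b x0 y
      (FBSNet.average (N : ℕ) '' D) (V N)) :
    (∃ φ : ℕ → ℕ+, StrictMono φ ∧ ∃ u ∈ D,
      Tendsto (fun i => FBSNet.extend T p (V (φ i))) atTop (𝓝 u) ∧
      FBSNet.SolvesControlProblem R L ψ β₁ β₂ β₃ b x0 y D u) ∧
    (∀ φ : ℕ → ℕ+, StrictMono φ → ∀ u : FBSNet.Control m n T p,
      Tendsto (fun i => FBSNet.extend T p (V (φ i))) atTop (𝓝 u) →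
      FBSNet.SolvesControlProblem R L ψ β₁ β₂ β₃ b x0 y D u) := by
  have hVD : ∀ N, FBSNet.extend T p (V N) ∈ D := by
    intro N
    obtain ⟨d, hd, hdV⟩ := (hV N).1
    rw [← hdV]
    exact hDproj N d hd
  obtain ⟨C, hC, hDC⟩ := hDbdd.exists_ae_norm_le
  have hDN : ∀ N : ℕ+, ∀ W ∈ FBSNet.average (N : ℕ) '' D,
      (∀ k, ‖W k‖ ≤ C) ∧ ∀ k, 0 ≤ (W k).step ∧ 0 ≤ (W k).reg := by
    rintro N _ ⟨d, hd, rfl⟩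
    exact ⟨FBSNet.norm_average_le hT (hDC d hd), FBSNet.average_nonneg hT (hDnonneg d hd)⟩
  have main : ∀ φ : ℕ → ℕ+, StrictMono φ → ∀ u : FBSNet.Control m n T p,
      Tendsto (fun i => FBSNet.extend T p (V (φ i))) atTop (𝓝 u) →
      FBSNet.SolvesControlProblem R L ψ β₁ β₂ β₃ b x0 y D u := by
    intro φ hφ u hu
    have huD : u ∈ D := hDclosed.mem_of_tendsto hu (Eventually.of_forall fun i => hVD (φ i))
    have htop : ∀ σ : ℕ → ℕ, StrictMono σ → Tendsto (fun i => (φ (σ i) : ℕ)) atTop atTop :=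
      fun σ hσ => (show StrictMono fun i => (φ (σ i) : ℕ) from
        fun i j hij => hφ (hσ hij)).tendsto_atTop
    choose X hX hopt using fun N => (hV N).2
    obtain ⟨σ₁, hσ₁, hlim₁⟩ := FBSNet.exists_subseq_ae_tendsto_stepFun
      (N := fun i => (φ i : ℕ)) hu
    obtain ⟨σ₂, hσ₂, x, hx, hxT⟩ := FBSNet.exists_trajectory_of_tendsto hT hA1 hA2 hA3 hC
      (N := fun i => (φ (σ₁ i) : ℕ)) (fun i => (φ (σ₁ i)).pos) (htop σ₁ hσ₁)
      (fun i => (hDN _ _ (hV _).1).2) (fun i => (hDN _ _ (hV _).1).1) (hDnonneg u huD) hlim₁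
      (fun i => hX _)
    refine ⟨huD, x, hx, fun w hw z hz => ?_⟩
    set τ : ℕ → ℕ := fun i => σ₁ (σ₂ i) with hτ
    have hτm : StrictMono τ := hσ₁.comp hσ₂
    have hwN : ∀ N : ℕ+, FBSNet.average (N : ℕ) w ∈ FBSNet.average (N : ℕ) '' D :=
      fun N => mem_image_of_mem _ hw
    -- Recovery sequence: the averages of `w` are admissible at every level and have network states.
    choose Z hZ using fun N : ℕ+ =>
      FBSNet.exists_isNetworkState hT.le hA1 hA2 b x0 (hDN N _ (hwN N)).2
    obtain ⟨σ₃, hσ₃, hlim₃⟩ := FBSNet.exists_subseq_ae_tendsto_stepFun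
      (hDequi.tendsto_extend_average hp hT hw (N := fun i => (φ (τ i) : ℕ))
        (fun i => (φ (τ i)).pos) (htop τ hτm))
    obtain ⟨σ₄, hσ₄, z', hz', hzT⟩ := FBSNet.exists_trajectory_of_tendsto hT hA1 hA2 hA3 hC
      (N := fun i => (φ (τ (σ₃ i)) : ℕ)) (fun i => (φ (τ (σ₃ i))).pos)
      (htop _ (hτm.comp hσ₃)) (fun i => (hDN _ _ (hwN _)).2) (fun i => (hDN _ _ (hwN _)).1)
      (hDnonneg w hw) hlim₃ (fun i => hZ _)
    -- The constructed limit need not be the given `z`, but both trajectories of `w` end at the same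
    -- point.
    rw [hz'.eq_at_end hT (hDnonneg w hw) hz] at hzT
    have hσ₃₄ : Tendsto (fun i => σ₃ (σ₄ i)) atTop atTop := (hσ₃.comp hσ₄).tendsto_atTop
    -- Both cost limits are taken along the same final subsequence, so the inequalities `hopt`
    -- compare them term by term.
    have hcost₁ := FBSNet.tendsto_networkCost (p := p) hA4.1 hA5.1.continuous β₁ β₂ β₃ y hC hT
      (N := fun i => (φ (τ (σ₃ (σ₄ i))) : ℕ)) (fun i => (φ _).pos)
      (fun i => (hDN _ _ (hV _).1).1) (u := u)
      (by filter_upwards [hlim₁] with t ht using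
        ht.comp (hσ₂.tendsto_atTop.comp hσ₃₄)) (hxT.comp hσ₃₄)
    have hcost₂ := FBSNet.tendsto_networkCost (p := p) hA4.1 hA5.1.continuous β₁ β₂ β₃ y hC hT
      (N := fun i => (φ (τ (σ₃ (σ₄ i))) : ℕ)) (fun i => (φ _).pos)
      (fun i => (hDN _ _ (hwN _)).1) (u := w)
      (by filter_upwards [hlim₃] with t ht using ht.comp hσ₄.tendsto_atTop) hzT
    exact le_of_tendsto_of_tendsto' hcost₁ hcost₂ fun i => hopt _ _ (hwN _) _ (hZ _)
  refine ⟨?_, main⟩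
  obtain ⟨u, huD, σ, hσ, hu⟩ := (FBSNet.isCompact_of_translationEquicontinuous hp hT hDbdd hDclosed
    hDequi).tendsto_subseq (fun i : ℕ => hVD i.succPNat)
  have hmono : StrictMono fun i => (σ i).succPNat := fun i j hij =>
    Nat.succPNat_lt_succPNat.2 (hσ hij)
  exact ⟨_, hmono, u, huD, hu, main _ hmono u hu⟩
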